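/- Let $d\ge 1$, let $\Omega\subset\mathbb R^d$ be a bounded domain with smooth boundary, $T>0$, and let $$A v=-\sum_{i,j=1}^d\partial_j(a_{ij}\partial_i v)+\sum_{j=1}^d b_j\,\partial_j v+c\,v$$ with real coefficients $a_{ij}=a_{ji}\in C^1(\overline\Omega)$, $b_j,c\in C(\overline\Omega)$, such that for some $\kappa>0$ one has $\sum_{i,j}a_{ij}(x)\xi_i\xi_j\ge\kappa\sum_j|\xi_j|^2$ for all $x\in\Omega$, $\xi\in\mathbb R^d$. All function spaces are real. For a Hilbert space $X$ and $0<\gamma<1$, let $H^\gamma(0,T;X)$ be the Sobolev–Slobodeckij space with norm $\big(\|v\|_{L^2(0,T;X)}^2+\int_0^T\!\int_0^T\frac{\|v(t)-v(s)\|_X^2}{|t-s|^{1+2\gamma}}\,dt\,ds\big)^{1/2}$. Let ${}_\gamma H(0,T;X)$ and ${}^\gamma H(0,T;X)$ be the closures in $H^\gamma(0,T;X)$ of the functions $v\in C^1([0,T];X)$ with $v(0)=0$ and with $v(T)=0$, respectively. Let ${}^{-\gamma}H(0,T;X)$ be the dual space of ${}^\gamma H(0,T;X)$, where $X$ is identified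 with its dual and $L^2(0,T;X)\subset{}^{-\gamma}H(0,T;X)$ through the inner product of $L^2(0,T;X)$; write ${}^{-\gamma}H(0,T)={}^{-\gamma}H(0,T;\mathbb R)$. A bounded operator $B:X\to Y$ between Hilbert spaces acts as ${}^{-\gamma}H(0,T;X)\to{}^{-\gamma}H(0,T;Y)$ by $\langle By,\varphi\rangle=\langle y,B^*\varphi\rangle$. This gives a meaning to $A u$, with $A:H^2(\Omega)\cap H^1_0(\Omega)\to L^2(\Omega)$, to $\mu f$ for $\mu\in{}^{-\gamma}H(0,T)$ and $f\in L^2(\Omega)$, and to the inclusion of ${}^{-\gamma}H(0,T;H^2(\Omega)\cap H_0^1(\Omega))$ in ${}^{-\gamma}H(0,T;L^2(\Omega))$. Let $(J^\gamma w)(t)=\frac1{\Gamma(\gamma)}\int_t^T(s-t)^{\gamma-1}w(s)\,ds$ be the backward Riemann–Liouville integral, $J^\gamma:L^2(0,T;X)\to{}^\gamma H(0,T;X)$, let $(J^\gamma)':{}^{-\gamma}H(0,T;X)\to L^2(0,T;X)$ be its dual operator, $\langle (J^\gamma)'y,w\rangle=\langle y,J^\gamma w\rangle$, and set $\partial_t^\gamma:=((J^\gamma)')^{-1}$.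 **Proposition.** Let $0<\alpha<1$, $\alpha\le\beta<1$, $\beta>1/2$, $\mu\in{}^{-\beta}H(0,T)$, $f\in L^2(\Omega)$, and let $$u\in L^2(0,T;L^2(\Omega))\cap{}^{-\beta}H(0,T;H^2(\Omega)\cap H^1_0(\Omega))$$ satisfy $$(\partial_t^\alpha+A)u=\mu f\quad\text{in }{}^{-\beta}H(0,T;L^2(\Omega)).$$ Then $v:=(J^\beta)'u$ and $(J^\beta)'\mu$ are well defined elements of $L^2(0,T;L^2(\Omega))$ and $L^2(0,T)$ respectively (they exist and are unique), $$v\in{}_\beta H(0,T;L^2(\Omega))\cap L^2(0,T;H^2(\Omega)\cap H^1_0(\Omega)),$$ and $v$ satisfies $$(\partial_t^\alpha+A)v=\big((J^\beta)'\mu\big)f\quad\text{in }L^2(0,T;L^2(\Omega));$$ in particular $\partial_t^\alpha v\in L^2(0,T;L^2(\Omega))$. -/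

import Mathlib

open MeasureTheory Set Filter Topology
open scoped ENNReal NNReal ContDiff

noncomputable section

namespace FracDiff

/-! ## Function spaces in time -/

section Time

variable {X Y : Type*} [NormedAddCommGroup X] [NormedAddCommGroup Y]

/-- Lebesgue measure on the time interval `(0,T)`. -/
abbrev timeMeasure (T : ℝ) : Measure ℝ := volume.restrict (Ioo 0 T)

/-- The space `L²(0,T;X)`. -/
abbrev L2T (T : ℝ) (X : Type*) [NormedAddCommGroup X] : Type _ := Lp X 2 (timeMeasure T)

variable [NormedSpace ℝ X] [NormedSpace ℝ Y]

/-- The difference quotient `(t,s) ↦ |t-s|^{-(1/2+β)} (f(t) - f(s))`, whose squared norm is the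
integrand `‖f(t)-f(s)‖² / |t-s|^{1+2β}` of the Sobolev-Slobodeckij seminorm. -/
def diffQuot (β : ℝ) (f : ℝ → X) : ℝ × ℝ → X :=
  fun p => (|p.1 - p.2| ^ (-(1 / 2 + β))) • (f p.1 - f p.2)

/-- The norm of `H^β(0,T;X)`,
`(‖f‖²_{L²} + ∬ ‖f(t)-f(s)‖² / |t-s|^{1+2β} dt ds)^{1/2}`, as an extended nonnegative number. -/
def slobENorm (T β : ℝ) (f : ℝ → X) : ℝ≥0∞ :=
  (eLpNorm f 2 (timeMeasure T) ^ (2 : ℝ) +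
    eLpNorm (diffQuot β f) 2 ((timeMeasure T).prod (timeMeasure T)) ^ (2 : ℝ)) ^ (1 / 2 : ℝ)

theorem diffQuot_congr {T : ℝ} (β : ℝ) {f g : ℝ → X} (h : f =ᵐ[timeMeasure T] g) :
    diffQuot β f =ᵐ[(timeMeasure T).prod (timeMeasure T)] diffQuot β g := by
  have h1 := (Measure.quasiMeasurePreserving_fst (μ := timeMeasure T)
    (ν := timeMeasure T)).ae_eq_comp h
  have h2 := (Measure.quasiMeasurePreserving_snd (μ := timeMeasure T)
    (ν := timeMeasure T)).ae_eq_comp h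
  filter_upwards [h1, h2] with p hp1 hp2
  simp only [Function.comp] at hp1 hp2
  simp only [diffQuot, hp1, hp2]

theorem slobENorm_congr {T : ℝ} (β : ℝ) {f g : ℝ → X} (h : f =ᵐ[timeMeasure T] g) :
    slobENorm T β f = slobENorm T β g := by
  rw [slobENorm, slobENorm, eLpNorm_congr_ae h, eLpNorm_congr_ae (diffQuot_congr β h)]

theorem diffQuot_aesm {T : ℝ} (β : ℝ) {f : ℝ → X}
    (hf : AEStronglyMeasurable f (timeMeasure T)) :
    AEStronglyMeasurable (diffQuot β f) ((timeMeasure T).prod (timeMeasure T)) := by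
  have h1 : AEStronglyMeasurable (fun p : ℝ × ℝ => f p.1)
      ((timeMeasure T).prod (timeMeasure T)) := hf.comp_fst
  have h2 : AEStronglyMeasurable (fun p : ℝ × ℝ => f p.2)
      ((timeMeasure T).prod (timeMeasure T)) := hf.comp_snd
  refine AEStronglyMeasurable.smul ?_ (h1.sub h2)
  exact Measurable.aestronglyMeasurable (by fun_prop)

theorem slobENorm_le_of_le {T β γ : ℝ} {f : ℝ → X} {g : ℝ → Y} (C : ℝ≥0)
    (h1 : eLpNorm f 2 (timeMeasure T) ≤ C * eLpNorm g 2 (timeMeasure T))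
    (h2 : eLpNorm (diffQuot β f) 2 ((timeMeasure T).prod (timeMeasure T)) ≤
      C * eLpNorm (diffQuot γ g) 2 ((timeMeasure T).prod (timeMeasure T))) :
    slobENorm T β f ≤ C * slobENorm T γ g := by
  unfold slobENorm
  have hC : (C : ℝ≥0∞) = ((C : ℝ≥0∞) ^ (2 : ℝ)) ^ (1 / 2 : ℝ) := by
    rw [← ENNReal.rpow_mul]; norm_num
  conv_rhs => rw [hC]
  rw [← ENNReal.mul_rpow_of_nonneg _ _ (by norm_num : (0 : ℝ) ≤ 1 / 2), mul_add,
    ← ENNReal.mul_rpow_of_nonneg _ _ (by norm_num : (0 : ℝ) ≤ 2),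
    ← ENNReal.mul_rpow_of_nonneg _ _ (by norm_num : (0 : ℝ) ≤ 2)]
  gcongr

theorem slobENorm_add_le {T β : ℝ} {f g : ℝ → X}
    (hf : AEStronglyMeasurable f (timeMeasure T))
    (hg : AEStronglyMeasurable g (timeMeasure T)) :
    slobENorm T β (f + g) ≤ slobENorm T β f + slobENorm T β g := by
  have hD : diffQuot β (f + g) = diffQuot β f + diffQuot β g := by
    funext p
    simp only [diffQuot, Pi.add_apply, ← smul_add]
    congr 1
    abel
  have h1 := eLpNorm_add_le hf hg (by norm_num : (1 : ℝ≥0∞) ≤ 2)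
  have h2 := eLpNorm_add_le (diffQuot_aesm β hf) (diffQuot_aesm β hg)
    (by norm_num : (1 : ℝ≥0∞) ≤ 2)
  rw [← hD] at h2
  have key := ENNReal.Lp_add_le (Finset.univ : Finset (Fin 2))
    ![eLpNorm f 2 (timeMeasure T),
      eLpNorm (diffQuot β f) 2 ((timeMeasure T).prod (timeMeasure T))]
    ![eLpNorm g 2 (timeMeasure T),
      eLpNorm (diffQuot β g) 2 ((timeMeasure T).prod (timeMeasure T))]
    (by norm_num : (1 : ℝ) ≤ 2)
  simp only [Fin.sum_univ_two, Matrix.cons_val_zero, Matrix.cons_val_one] at key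
  refine le_trans ?_ key
  unfold slobENorm
  gcongr

theorem slobENorm_comp_le {T β : ℝ} (B : X →L[ℝ] Y) (f : ℝ → X) :
    slobENorm T β (fun t => B (f t)) ≤ ‖B‖₊ * slobENorm T β f := by
  refine slobENorm_le_of_le _ ?_ ?_
  · exact eLpNorm_le_nnreal_smul_eLpNorm_of_ae_le_mul
      (Eventually.of_forall fun t => B.le_opNNNorm _) 2
  · refine eLpNorm_le_nnreal_smul_eLpNorm_of_ae_le_mul (Eventually.of_forall fun p => ?_) 2
    have : diffQuot β (fun t => B (f t)) p = B (diffQuot β f p) := by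
      simp [diffQuot]
    rw [this]
    exact B.le_opNNNorm _

theorem slobENorm_smul_le {T β : ℝ} (c : ℝ) (f : ℝ → X) :
    slobENorm T β (fun t => c • f t) ≤
      ‖c • ContinuousLinearMap.id ℝ X‖₊ * slobENorm T β f :=
  slobENorm_comp_le (c • ContinuousLinearMap.id ℝ X) f

theorem slobENorm_mono {T α β : ℝ} (hαβ : α ≤ β) (f : ℝ → X) :
    slobENorm T α f ≤ (max 1 (Real.toNNReal (T ^ (β - α))) : ℝ≥0) * slobENorm T β f := by
  refine slobENorm_le_of_le _ ?_ ?_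
  · refine le_mul_of_one_le_left' ?_
    exact_mod_cast le_max_left 1 _
  · refine eLpNorm_le_nnreal_smul_eLpNorm_of_ae_le_mul ?_ 2
    have hmem : ∀ᵐ p ∂((timeMeasure T).prod (timeMeasure T)), p ∈ Ioo 0 T ×ˢ Ioo 0 T := by
      rw [timeMeasure, Measure.prod_restrict]
      exact ae_restrict_mem (measurableSet_Ioo.prod measurableSet_Ioo)
    filter_upwards [hmem] with p hp
    obtain ⟨⟨h1, h2⟩, h3, h4⟩ := hp
    by_cases hd : p.1 = p.2
    · simp [diffQuot, hd]
    have hpos : 0 < |p.1 - p.2| := abs_pos.2 (sub_ne_zero.2 hd)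
    have hlt : |p.1 - p.2| ≤ T := abs_le.2 ⟨by linarith, by linarith⟩
    have hsplit : |p.1 - p.2| ^ (-(1 / 2 + α)) =
        |p.1 - p.2| ^ (β - α) * |p.1 - p.2| ^ (-(1 / 2 + β)) := by
      rw [← Real.rpow_add hpos]; congr 1; ring
    have hT : |p.1 - p.2| ^ (β - α) ≤ T ^ (β - α) :=
      Real.rpow_le_rpow hpos.le hlt (by linarith)
    rw [← NNReal.coe_le_coe]
    push_cast
    rw [Real.coe_toNNReal _ (Real.rpow_nonneg (by linarith) _)]
    simp only [diffQuot, norm_smul, hsplit, Real.norm_eq_abs, abs_mul,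
      abs_of_nonneg (Real.rpow_nonneg hpos.le _)]
    rw [mul_assoc]
    gcongr
    exact hT.trans (le_max_right _ _)

/-- `C¹[0,T]` functions with values in `X` that vanish at the point `e`. -/
def IsC1Vanishing (T e : ℝ) (ψ : ℝ → X) : Prop :=
  ContDiffOn ℝ 1 ψ (Icc 0 T) ∧ ψ e = 0

theorem IsC1Vanishing.aesm {T e : ℝ} {ψ : ℝ → X} (h : IsC1Vanishing T e ψ) :
    AEStronglyMeasurable ψ (timeMeasure T) :=
  (h.1.continuousOn.mono Ioo_subset_Icc_self).aestronglyMeasurable measurableSet_Ioo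

/-- The closure in `H^β(0,T;X)` of the `C¹[0,T]` functions vanishing at `e`, as a subspace of
`L²(0,T;X)`. For `e = 0` this is the space `_βH(0,T;X)`, for `e = T` the space `^βH(0,T;X)`. -/
def fracH (T e β : ℝ) (X : Type*) [NormedAddCommGroup X] [NormedSpace ℝ X] :
    Submodule ℝ (L2T T X) where
  carrier := {φ | slobENorm T β φ < ⊤ ∧
    ∀ ε : ℝ≥0∞, 0 < ε → ∃ ψ : ℝ → X, IsC1Vanishing T e ψ ∧
      slobENorm T β (fun t => φ t - ψ t) < ε}
  zero_mem' := by
    have h0 : slobENorm T β (fun _ : ℝ => (0 : X)) = 0 := by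
      have : diffQuot β (fun _ : ℝ => (0 : X)) = 0 := by funext p; simp [diffQuot]
      simp [slobENorm, this]
    have hz := Lp.coeFn_zero X 2 (timeMeasure T)
    refine ⟨?_, fun ε hε => ⟨fun _ => 0, ⟨contDiffOn_const, rfl⟩, ?_⟩⟩
    · rw [slobENorm_congr β hz]
      exact h0 ▸ ENNReal.zero_lt_top
    · simp only [sub_zero]
      rw [slobENorm_congr β hz]
      exact h0.trans_lt hε
  add_mem' := by
    rintro a b ⟨ha, ha'⟩ ⟨hb, hb'⟩
    have hab := Lp.coeFn_add a b
    refine ⟨?_, fun ε hε => ?_⟩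
    · rw [slobENorm_congr β hab]
      exact (slobENorm_add_le (Lp.aestronglyMeasurable a) (Lp.aestronglyMeasurable b)).trans_lt
        (ENNReal.add_lt_top.2 ⟨ha, hb⟩)
    · obtain ⟨ψ, hψ, h1⟩ := ha' (ε / 2) (ENNReal.half_pos hε.ne')
      obtain ⟨χ, hχ, h2⟩ := hb' (ε / 2) (ENNReal.half_pos hε.ne')
      refine ⟨ψ + χ, ⟨hψ.1.add hχ.1, by simp [hψ.2, hχ.2]⟩, ?_⟩
      have heq : (fun t => (a + b : L2T T X) t - (ψ + χ) t) =ᵐ[timeMeasure T]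
          (fun t => a t - ψ t) + fun t => b t - χ t := by
        filter_upwards [hab] with t ht
        rw [ht]
        simp only [Pi.add_apply]
        abel
      rw [slobENorm_congr β heq]
      refine (slobENorm_add_le ((Lp.aestronglyMeasurable a).sub hψ.aesm)
        ((Lp.aestronglyMeasurable b).sub hχ.aesm)).trans_lt ?_
      exact (ENNReal.add_lt_add h1 h2).trans_eq (ENNReal.add_halves ε)
  smul_mem' := by
    rintro c a ⟨ha, ha'⟩
    have hca := Lp.coeFn_smul c a
    set C : ℝ≥0 := ‖c • ContinuousLinearMap.id ℝ X‖₊ with hC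
    refine ⟨?_, fun ε hε => ?_⟩
    · rw [slobENorm_congr β hca]
      exact (slobENorm_smul_le c a).trans_lt (ENNReal.mul_lt_top ENNReal.coe_lt_top ha)
    · obtain ⟨ψ, hψ, h1⟩ := ha' (ε / (C + 1 : ℝ≥0))
        (ENNReal.div_pos hε.ne' ENNReal.coe_ne_top)
      refine ⟨fun t => c • ψ t, ⟨contDiffOn_const.smul hψ.1, by simp [hψ.2]⟩, ?_⟩
      have heq : (fun t => (c • a : L2T T X) t - c • ψ t) =ᵐ[timeMeasure T]
          (fun t => c • (a t - ψ t)) := by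
        filter_upwards [hca] with t ht
        rw [ht, Pi.smul_apply, smul_sub]
      rw [slobENorm_congr β heq]
      refine (slobENorm_smul_le c _).trans_lt ?_
      refine lt_of_le_of_lt ?_ (ENNReal.mul_lt_of_lt_div' h1)
      gcongr
      exact_mod_cast (le_self_add : C ≤ C + 1)

theorem mem_fracH {T e β : ℝ} {φ : L2T T X} : φ ∈ fracH T e β X ↔ slobENorm T β φ < ⊤ ∧
    ∀ ε : ℝ≥0∞, 0 < ε → ∃ ψ : ℝ → X, IsC1Vanishing T e ψ ∧
      slobENorm T β (fun t => φ t - ψ t) < ε := Iff.rfl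

theorem fracH_mono {T e α β : ℝ} (hαβ : α ≤ β) : fracH T e β X ≤ fracH T e α X := by
  rintro φ ⟨h, h'⟩
  set C : ℝ≥0 := max 1 (Real.toNNReal (T ^ (β - α))) with hC
  have hC0 : C ≠ 0 := (lt_of_lt_of_le one_pos (le_max_left _ _)).ne'
  refine ⟨(slobENorm_mono hαβ _).trans_lt (ENNReal.mul_lt_top ENNReal.coe_lt_top h),
    fun ε hε => ?_⟩
  obtain ⟨ψ, hψ, h1⟩ := h' (ε / C) (ENNReal.div_pos hε.ne' ENNReal.coe_ne_top)
  exact ⟨ψ, hψ, (slobENorm_mono hαβ _).trans_lt (ENNReal.mul_lt_of_lt_div' h1)⟩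

theorem compLp_mem_fracH {T e β : ℝ} (B : X →L[ℝ] Y) {φ : L2T T X}
    (hφ : φ ∈ fracH T e β X) : B.compLp φ ∈ fracH T e β Y := by
  obtain ⟨h, h'⟩ := hφ
  have hB := B.coeFn_compLp' φ
  refine ⟨?_, fun ε hε => ?_⟩
  · rw [slobENorm_congr β hB]
    exact (slobENorm_comp_le B φ).trans_lt (ENNReal.mul_lt_top ENNReal.coe_lt_top h)
  · obtain ⟨ψ, hψ, h1⟩ := h' (ε / (‖B‖₊ + 1 : ℝ≥0))
      (ENNReal.div_pos hε.ne' ENNReal.coe_ne_top)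
    refine ⟨fun t => B (ψ t), ⟨B.contDiff.comp_contDiffOn hψ.1, by simp [hψ.2]⟩, ?_⟩
    have heq : (fun t => (B.compLp φ : L2T T Y) t - B (ψ t)) =ᵐ[timeMeasure T]
        (fun t => B (φ t - ψ t)) := by
      filter_upwards [hB] with t ht
      rw [ht, map_sub]
    rw [slobENorm_congr β heq]
    refine (slobENorm_comp_le B _).trans_lt ?_
    refine lt_of_le_of_lt ?_ (ENNReal.mul_lt_of_lt_div' h1)
    gcongr
    simp

/-- A bounded operator `B : X → Y` acts pointwise in time, `^βH(0,T;X) → ^βH(0,T;Y)`. -/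
def fracHMap {T e β : ℝ} (B : X →L[ℝ] Y) : fracH T e β X →ₗ[ℝ] fracH T e β Y :=
  ((B.compLpL 2 (timeMeasure T)).toLinearMap).restrict fun _ hφ => compLp_mem_fracH B hφ

/-- The space `^{-β}H(0,T;X) = (^βH(0,T;X))'`: the linear functionals on `^βH(0,T;X)` that are
bounded for the norm of `H^β(0,T;X)`. (`X` is a real Hilbert space, identified with its dual.) -/
def NegH (T β : ℝ) (X : Type*) [NormedAddCommGroup X] [NormedSpace ℝ X] :
    Submodule ℝ (fracH T T β X →ₗ[ℝ] ℝ) where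
  carrier := {y | ∃ C : ℝ, ∀ φ, |y φ| ≤ C * (slobENorm T β (φ : L2T T X)).toReal}
  zero_mem' := ⟨0, fun φ => by simp⟩
  add_mem' := by
    rintro a b ⟨C, hC⟩ ⟨D, hD⟩
    refine ⟨C + D, fun φ => ?_⟩
    rw [LinearMap.add_apply, add_mul]
    exact (abs_add_le _ _).trans (add_le_add (hC φ) (hD φ))
  smul_mem' := by
    rintro c a ⟨C, hC⟩
    refine ⟨|c| * C, fun φ => ?_⟩
    rw [LinearMap.smul_apply, smul_eq_mul, abs_mul, mul_assoc]
    exact mul_le_mul_of_nonneg_left (hC φ) (abs_nonneg c)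

/-- For `α ≤ β`, the inclusion `^{-α}H(0,T;X) ⊂ ^{-β}H(0,T;X)` (restriction of functionals to
`^βH(0,T;X) ⊂ ^αH(0,T;X)`). -/
def negIncl {T α β : ℝ} (hαβ : α ≤ β) (y : NegH T α X) : NegH T β X :=
  ⟨(y : fracH T T α X →ₗ[ℝ] ℝ) ∘ₗ Submodule.inclusion (fracH_mono hαβ), by
    obtain ⟨C, hC⟩ := y.2
    refine ⟨|C| * (max 1 (Real.toNNReal (T ^ (β - α))) : ℝ≥0), fun φ => ?_⟩
    refine (hC (Submodule.inclusion (fracH_mono hαβ) φ)).trans ?_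
    have h := slobENorm_mono (T := T) hαβ (φ : L2T T X)
    have h2 := ENNReal.toReal_mono (ENNReal.mul_ne_top ENNReal.coe_ne_top φ.2.1.ne) h
    rw [ENNReal.toReal_mul, ENNReal.coe_toReal] at h2
    rw [mul_assoc]
    exact mul_le_mul (le_abs_self C) h2 ENNReal.toReal_nonneg (abs_nonneg C)⟩

end Time

section TimeHilbert

variable {X Y : Type*} [NormedAddCommGroup X] [InnerProductSpace ℝ X]
  [NormedAddCommGroup Y] [InnerProductSpace ℝ Y]

/-- The embedding `L²(0,T;X) ⊂ ^{-β}H(0,T;X)` of the Gel'fand triple: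
`u ↦ (φ ↦ ∫_0^T ⟨u(t), φ(t)⟩_X dt)`. -/
def negOfL2 {T : ℝ} (β : ℝ) (u : L2T T X) : NegH T β X :=
  ⟨(innerSL ℝ u).toLinearMap ∘ₗ (fracH T T β X).subtype, by
    refine ⟨‖u‖, fun φ => (abs_real_inner_le_norm u (φ : L2T T X)).trans ?_⟩
    refine mul_le_mul_of_nonneg_left ?_ (norm_nonneg u)
    rw [Lp.norm_def]
    refine ENNReal.toReal_mono φ.2.1.ne ?_
    unfold slobENorm
    calc eLpNorm (φ : L2T T X) 2 (timeMeasure T)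
        = (eLpNorm (φ : L2T T X) 2 (timeMeasure T) ^ (2 : ℝ)) ^ (1 / 2 : ℝ) := by
          rw [← ENNReal.rpow_mul]; norm_num
      _ ≤ _ := by gcongr; exact le_self_add⟩

/-- The extension of a bounded operator `B : X → Y` between Hilbert spaces to
`^{-β}H(0,T;X) → ^{-β}H(0,T;Y)`, given by `⟨B y, φ⟩ = ⟨y, B* φ⟩`; on `L²(0,T;X)` it is
`u ↦ B ∘ u`. -/
def negMap {T β : ℝ} [CompleteSpace X] [CompleteSpace Y] (B : X →L[ℝ] Y)
    (y : NegH T β X) : NegH T β Y :=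
  ⟨(y : fracH T T β X →ₗ[ℝ] ℝ) ∘ₗ fracHMap (ContinuousLinearMap.adjoint B), by
    obtain ⟨C, hC⟩ := y.2
    set B' := ContinuousLinearMap.adjoint B
    refine ⟨|C| * ‖B'‖₊, fun φ => ?_⟩
    refine (hC (fracHMap B' φ)).trans ?_
    have h : slobENorm T β ((fracHMap B' φ : fracH T T β X) : L2T T X) ≤
        ‖B'‖₊ * slobENorm T β (φ : L2T T Y) :=
      (slobENorm_congr β (B'.coeFn_compLp' (φ : L2T T Y))).trans_le (slobENorm_comp_le B' _)
    have h2 := ENNReal.toReal_mono (ENNReal.mul_ne_top ENNReal.coe_ne_top φ.2.1.ne) h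
    rw [ENNReal.toReal_mul, ENNReal.coe_toReal] at h2
    rw [mul_assoc]
    exact mul_le_mul (le_abs_self C) h2 ENNReal.toReal_nonneg (abs_nonneg C)⟩

/-- The map `B` on `^{-β}H` extends the pointwise action on `L²(0,T;X)`. -/
theorem negMap_negOfL2 {T β : ℝ} [CompleteSpace X] [CompleteSpace Y] (B : X →L[ℝ] Y)
    (u : L2T T X) : negMap B (negOfL2 β u) = negOfL2 β (B.compLp u) := by
  apply Subtype.ext
  apply LinearMap.ext
  intro φ
  change inner ℝ u ((ContinuousLinearMap.adjoint B).compLp (φ : L2T T Y)) =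
    inner ℝ (B.compLp u) (φ : L2T T Y)
  rw [L2.inner_def, L2.inner_def]
  refine integral_congr_ae ?_
  filter_upwards [B.coeFn_compLp' u,
    (ContinuousLinearMap.adjoint B).coeFn_compLp' (φ : L2T T Y)] with t h1 h2
  rw [h1, h2, ContinuousLinearMap.adjoint_inner_right]

/-- The backward Riemann-Liouville integral
`(J^β w)(t) = 1/Γ(β) ∫_t^T (s-t)^{β-1} w(s) ds`. -/
def rlBackward (T β : ℝ) (w : ℝ → X) (t : ℝ) : X :=
  (Real.Gamma β)⁻¹ • ∫ s in Ioo t T, ((s - t) ^ (β - 1)) • w s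

/-- `g = (J^β)' y`, where `(J^β)' : ^{-β}H(0,T;X) → L²(0,T;X)` is the dual operator of
`J^β : L²(0,T;X) → ^βH(0,T;X)`: one has `⟨g, w⟩ = ⟨y, J^β w⟩` for all `w`. -/
def IsDualRL {T β : ℝ} (y : NegH T β X) (g : L2T T X) : Prop :=
  ∀ (w : L2T T X) (φ : fracH T T β X),
    ((φ : L2T T X) : ℝ → X) =ᵐ[timeMeasure T] rlBackward T β w →
    inner ℝ g w = (y : fracH T T β X →ₗ[ℝ] ℝ) φ

/-- `z = ∂_t^α u`, where `∂_t^α = ((J^α)')⁻¹ : L²(0,T;X) → ^{-α}H(0,T;X)`. -/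
def IsCaputo {T α : ℝ} (u : L2T T X) (z : NegH T α X) : Prop := IsDualRL z u

end TimeHilbert

/-! ## Function spaces and the elliptic operator in space -/

section Space

/-- `ℝ^d`. -/
abbrev Sp (d : ℕ) : Type := EuclideanSpace ℝ (Fin d)

/-- The classical partial derivative `∂_i φ`. -/
def pd {d : ℕ} (i : Fin d) (φ : Sp d → ℝ) (x : Sp d) : ℝ :=
  fderiv ℝ φ x (EuclideanSpace.single i 1)

/-- A bounded domain in `ℝ^d` with smooth boundary: near each boundary point the domain is the
sublevel set `{ρ < 0}` of a smooth function `ρ` with nonvanishing differential. -/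
structure IsSmoothBoundedDomain {d : ℕ} (Ω : Set (Sp d)) : Prop where
  isOpen : IsOpen Ω
  isConnected : IsConnected Ω
  isBounded : Bornology.IsBounded Ω
  smooth_boundary : ∀ x ∈ frontier Ω, ∃ (U : Set (Sp d)) (ρ : Sp d → ℝ),
    IsOpen U ∧ x ∈ U ∧ ContDiffOn ℝ ∞ ρ U ∧ fderiv ℝ ρ x ≠ 0 ∧ Ω ∩ U = {y ∈ U | ρ y < 0}

variable {d : ℕ}

/-- The space `L²(Ω)`. -/
abbrev L2Ω (Ω : Set (Sp d)) : Type := Lp ℝ 2 (volume.restrict Ω)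

/-- Test functions, `φ ∈ C_c^∞(Ω)`. -/
def IsTest (Ω : Set (Sp d)) (φ : Sp d → ℝ) : Prop :=
  ContDiff ℝ ∞ φ ∧ HasCompactSupport φ ∧ tsupport φ ⊆ Ω

theorem IsTest.memLp {Ω : Set (Sp d)} {φ : Sp d → ℝ} (h : IsTest Ω φ) :
    MemLp φ 2 (volume.restrict Ω) :=
  (h.1.continuous.memLp_of_hasCompactSupport h.2.1).restrict Ω

theorem IsTest.memLp_pd {Ω : Set (Sp d)} {φ : Sp d → ℝ} (h : IsTest Ω φ) (i : Fin d) :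
    MemLp (pd i φ) 2 (volume.restrict Ω) := by
  have h1 : Continuous (pd i φ) := (h.1.continuous_fderiv (by simp)).clm_apply continuous_const
  have h2 : HasCompactSupport (pd i φ) := h.2.1.fderiv_apply ℝ _
  exact (h1.memLp_of_hasCompactSupport h2).restrict Ω

/-- `w` is the weak partial derivative `∂_i v` in `Ω`. -/
def IsWeakPartial (Ω : Set (Sp d)) (i : Fin d) (v w : L2Ω Ω) : Prop :=
  ∀ φ : Sp d → ℝ, IsTest Ω φ → ∫ x in Ω, v x * pd i φ x = -∫ x in Ω, w x * φ x

theorem isWeakPartial_iff {Ω : Set (Sp d)} {i : Fin d} {v w : L2Ω Ω} :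
    IsWeakPartial Ω i v w ↔ ∀ (φ : Sp d → ℝ) (hφ : IsTest Ω φ),
      inner ℝ v ((hφ.memLp_pd i).toLp (pd i φ)) + inner ℝ w (hφ.memLp.toLp φ) = 0 := by
  have key : ∀ (u : L2Ω Ω) (g : Sp d → ℝ) (hg : MemLp g 2 (volume.restrict Ω)),
      inner ℝ u (hg.toLp g) = ∫ x in Ω, u x * g x := by
    intro u g hg
    rw [L2.inner_def]
    refine integral_congr_ae ?_
    filter_upwards [hg.coeFn_toLp] with x hx
    rw [hx, RCLike.inner_apply]
    simp [mul_comm]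
  refine forall_congr' fun φ => forall_congr' fun hφ => ?_
  rw [key, key, eq_neg_iff_add_eq_zero]

/-- Labels of the derivatives of order at most two: `v`, `∂_i v`, `∂_j ∂_i v`. -/
abbrev Jet2 (d : ℕ) : Type := Unit ⊕ (Fin d ⊕ Fin d × Fin d)

/-- The label of `v` itself. -/
abbrev j0 : Jet2 d := Sum.inl ()

/-- The label of `∂_i v`. -/
abbrev j1 (i : Fin d) : Jet2 d := Sum.inr (Sum.inl i)

/-- The label of `∂_j ∂_i v`. -/
abbrev j2 (i j : Fin d) : Jet2 d := Sum.inr (Sum.inr (i, j))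

/-- The Hilbert sum of copies of `L²(Ω)` indexed by the derivatives of order at most two. -/
abbrev JetL2 (Ω : Set (Sp d)) : Type := PiLp 2 (fun _ : Jet2 d => L2Ω Ω)

/-- `v ∈ H¹₀(Ω)` with weak gradient `w`: the pair `(v, w)` is the limit in `L²(Ω)` of pairs `(φ, ∇φ)`
with `φ ∈ C_c^∞(Ω)`. -/
def IsH10 (Ω : Set (Sp d)) (v : L2Ω Ω) (w : Fin d → L2Ω Ω) : Prop :=
  ∀ ε : ℝ, 0 < ε → ∃ (φ : Sp d → ℝ) (hφ : IsTest Ω φ),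
    ‖v - hφ.memLp.toLp φ‖ < ε ∧ ∀ i, ‖w i - (hφ.memLp_pd i).toLp (pd i φ)‖ < ε

theorem IsWeakPartial.zero (Ω : Set (Sp d)) (i : Fin d) : IsWeakPartial Ω i 0 0 := by
  rw [isWeakPartial_iff]; intro φ hφ; simp

theorem IsWeakPartial.add {Ω : Set (Sp d)} {i : Fin d} {v w v' w' : L2Ω Ω}
    (h : IsWeakPartial Ω i v w) (h' : IsWeakPartial Ω i v' w') :
    IsWeakPartial Ω i (v + v') (w + w') := by
  rw [isWeakPartial_iff]; intro φ hφ
  have h1 := isWeakPartial_iff.1 h φ hφ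
  have h2 := isWeakPartial_iff.1 h' φ hφ
  simp only [inner_add_left]
  linarith

theorem IsWeakPartial.smul {Ω : Set (Sp d)} {i : Fin d} {v w : L2Ω Ω} (c : ℝ)
    (h : IsWeakPartial Ω i v w) : IsWeakPartial Ω i (c • v) (c • w) := by
  rw [isWeakPartial_iff]; intro φ hφ
  have h1 := isWeakPartial_iff.1 h φ hφ
  simp only [real_inner_smul_left]
  rw [← mul_add, h1, mul_zero]

theorem IsH10.zero (Ω : Set (Sp d)) : IsH10 Ω 0 (fun _ => 0) := by
  intro ε hε
  have h0 : IsTest Ω (0 : Sp d → ℝ) :=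
    ⟨contDiff_const, HasCompactSupport.zero, by simp [tsupport]⟩
  have hp : ∀ i, pd i (0 : Sp d → ℝ) = 0 := by
    intro i; funext x; simp [pd]
  refine ⟨0, h0, ?_, fun i => ?_⟩
  · rw [MemLp.toLp_zero]; simpa using hε
  · have : (h0.memLp_pd i).toLp (pd i 0) = 0 := by
      rw [Lp.ext_iff]
      filter_upwards [(h0.memLp_pd i).coeFn_toLp, Lp.coeFn_zero ℝ 2 (volume.restrict Ω)]
        with x h1 h2
      rw [h1, h2, hp i]
    rw [this]; simpa using hε

theorem IsH10.add {Ω : Set (Sp d)} {v v' : L2Ω Ω} {w w' : Fin d → L2Ω Ω}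
    (h : IsH10 Ω v w) (h' : IsH10 Ω v' w') : IsH10 Ω (v + v') (fun i => w i + w' i) := by
  intro ε hε
  obtain ⟨φ, hφ, a1, a2⟩ := h (ε / 2) (half_pos hε)
  obtain ⟨χ, hχ, b1, b2⟩ := h' (ε / 2) (half_pos hε)
  have hs : IsTest Ω (φ + χ) := ⟨hφ.1.add hχ.1, hφ.2.1.add hχ.2.1,
    (tsupport_add φ χ).trans (union_subset hφ.2.2 hχ.2.2)⟩
  have hpd : ∀ i, pd i (φ + χ) = pd i φ + pd i χ := by
    intro i; funext x
    have e1 := (hφ.1.differentiable (by simp)) x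
    have e2 := (hχ.1.differentiable (by simp)) x
    simp [pd, fderiv_add e1 e2]
  refine ⟨φ + χ, hs, ?_, fun i => ?_⟩
  · have : hs.memLp.toLp (φ + χ) = hφ.memLp.toLp φ + hχ.memLp.toLp χ :=
      MemLp.toLp_add hφ.memLp hχ.memLp
    rw [this, add_sub_add_comm]
    exact (norm_add_le _ _).trans_lt (by linarith)
  · have : (hs.memLp_pd i).toLp (pd i (φ + χ)) =
        (hφ.memLp_pd i).toLp (pd i φ) + (hχ.memLp_pd i).toLp (pd i χ) := by
      rw [← MemLp.toLp_add (hφ.memLp_pd i) (hχ.memLp_pd i)]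
      exact MemLp.toLp_congr _ _ (by rw [hpd i])
    rw [this, add_sub_add_comm]
    have := a2 i
    have := b2 i
    exact (norm_add_le _ _).trans_lt (by linarith)

theorem IsH10.smul {Ω : Set (Sp d)} {v : L2Ω Ω} {w : Fin d → L2Ω Ω} (c : ℝ)
    (h : IsH10 Ω v w) : IsH10 Ω (c • v) (fun i => c • w i) := by
  intro ε hε
  have hc : 0 < |c| + 1 := by positivity
  obtain ⟨φ, hφ, a1, a2⟩ := h (ε / (|c| + 1)) (div_pos hε hc)
  have hs : IsTest Ω (c • φ) := ⟨contDiff_const.smul hφ.1,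
    hφ.2.1.mono (Function.support_const_smul_subset c φ),
    (closure_mono (Function.support_const_smul_subset c φ)).trans hφ.2.2⟩
  have hpd : ∀ i, pd i (c • φ) = c • pd i φ := by
    intro i; funext x
    have e1 := (hφ.1.differentiable (by simp)) x
    simp [pd, fderiv_const_smul e1]
  have hlt : ∀ a : L2Ω Ω, ‖a‖ < ε / (|c| + 1) → ‖c • a‖ < ε := by
    intro a ha
    rw [norm_smul, Real.norm_eq_abs]
    rw [lt_div_iff₀ hc] at ha
    nlinarith [norm_nonneg a]
  refine ⟨c • φ, hs, ?_, fun i => ?_⟩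
  · have : hs.memLp.toLp (c • φ) = c • hφ.memLp.toLp φ :=
      MemLp.toLp_const_smul c hφ.memLp
    rw [this, ← smul_sub]
    exact hlt _ a1
  · have : (hs.memLp_pd i).toLp (pd i (c • φ)) = c • (hφ.memLp_pd i).toLp (pd i φ) := by
      rw [← MemLp.toLp_const_smul c (hφ.memLp_pd i)]
      exact MemLp.toLp_congr _ _ (by rw [hpd i])
    rw [this, ← smul_sub]
    exact hlt _ (a2 i)

theorem isClosed_isWeakPartial (Ω : Set (Sp d)) (i : Fin d) :
    IsClosed {q : L2Ω Ω × L2Ω Ω | IsWeakPartial Ω i q.1 q.2} := by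
  simp only [isWeakPartial_iff, ofPred_forall]
  refine isClosed_iInter fun φ => isClosed_iInter fun hφ => ?_
  exact isClosed_eq (by fun_prop) continuous_const

theorem isClosed_isH10 (Ω : Set (Sp d)) :
    IsClosed {q : L2Ω Ω × (Fin d → L2Ω Ω) | IsH10 Ω q.1 q.2} := by
  refine isClosed_of_closure_subset fun p hp ε hε => ?_
  obtain ⟨q, hq, hpq⟩ := Metric.mem_closure_iff.1 hp (ε / 2) (half_pos hε)
  obtain ⟨φ, hφ, a1, a2⟩ := hq (ε / 2) (half_pos hε)
  rw [dist_eq_norm] at hpq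
  refine ⟨φ, hφ, ?_, fun i => ?_⟩
  · have := norm_sub_le_norm_sub_add_norm_sub p.1 q.1 (hφ.memLp.toLp φ)
    have : ‖p.1 - q.1‖ ≤ ‖p - q‖ := norm_fst_le (p - q)
    linarith
  · have := norm_sub_le_norm_sub_add_norm_sub (p.2 i) (q.2 i) ((hφ.memLp_pd i).toLp (pd i φ))
    have : ‖p.2 i - q.2 i‖ ≤ ‖p - q‖ :=
      (norm_le_pi_norm (p.2 - q.2) i).trans (norm_snd_le (p - q))
    have := a2 i
    linarith

/-- The family `p` consists of a function of `H²(Ω) ∩ H¹₀(Ω)` and of its weak derivatives of order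
one and two. -/
def IsH2H10 (Ω : Set (Sp d)) (p : JetL2 Ω) : Prop :=
  (∀ i, IsWeakPartial Ω i (p j0) (p (j1 i))) ∧
  (∀ i j, IsWeakPartial Ω j (p (j1 i)) (p (j2 i j))) ∧
  IsH10 Ω (p j0) (fun i => p (j1 i))

/-- The space `H²(Ω) ∩ H¹₀(Ω)` with the norm of `H²(Ω)`: a function `v` is represented by the family
of its weak derivatives `v, ∂_i v, ∂_j ∂_i v`, all in `L²(Ω)`. -/
def H2H10 (Ω : Set (Sp d)) : Submodule ℝ (JetL2 Ω) where
  carrier := {p | IsH2H10 Ω p}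
  zero_mem' := ⟨fun i => .zero Ω i, fun _ j => .zero Ω j, .zero Ω⟩
  add_mem' := fun hp hq => ⟨fun i => (hp.1 i).add (hq.1 i),
    fun i j => (hp.2.1 i j).add (hq.2.1 i j), hp.2.2.add hq.2.2⟩
  smul_mem' := fun c _ hp => ⟨fun i => (hp.1 i).smul c,
    fun i j => (hp.2.1 i j).smul c, hp.2.2.smul c⟩

theorem isClosed_H2H10 (Ω : Set (Sp d)) : IsClosed (H2H10 Ω : Set (JetL2 Ω)) := by
  have hk : ∀ k : Jet2 d, Continuous fun p : JetL2 Ω => p k := fun k =>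
    PiLp.continuous_apply 2 _ k
  have h1 : IsClosed {p : JetL2 Ω | ∀ i, IsWeakPartial Ω i (p j0) (p (j1 i))} := by
    simp only [ofPred_forall]
    exact isClosed_iInter fun i =>
      (isClosed_isWeakPartial Ω i).preimage ((hk j0).prodMk (hk (j1 i)))
  have h2 : IsClosed {p : JetL2 Ω | ∀ i j, IsWeakPartial Ω j (p (j1 i)) (p (j2 i j))} := by
    simp only [ofPred_forall]
    exact isClosed_iInter fun i => isClosed_iInter fun j =>
      (isClosed_isWeakPartial Ω j).preimage ((hk (j1 i)).prodMk (hk (j2 i j)))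
  have h3 : IsClosed {p : JetL2 Ω | IsH10 Ω (p j0) (fun i => p (j1 i))} :=
    (isClosed_isH10 Ω).preimage ((hk j0).prodMk (continuous_pi fun i => hk (j1 i)))
  exact h1.inter (h2.inter h3)

instance (Ω : Set (Sp d)) : CompleteSpace (H2H10 Ω) :=
  (isClosed_H2H10 Ω).completeSpace_coe

/-- The component `D_k v` (a derivative of order at most two) of `v ∈ H²(Ω) ∩ H¹₀(Ω)`. -/
def jet (Ω : Set (Sp d)) (k : Jet2 d) : H2H10 Ω →L[ℝ] L2Ω Ω :=
  (PiLp.proj 2 (fun _ : Jet2 d => L2Ω Ω) k : JetL2 Ω →L[ℝ] L2Ω Ω) ∘L (H2H10 Ω).subtypeL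

/-- The inclusion `H²(Ω) ∩ H¹₀(Ω) ⊂ L²(Ω)`. -/
def toL2Ω (Ω : Set (Sp d)) : H2H10 Ω →L[ℝ] L2Ω Ω := jet Ω j0

/-- `g ∈ C¹(Ω̄)`: `g` is continuous on the closure of `Ω` and continuously differentiable in `Ω`,
with partial derivatives that extend continuously to the closure of `Ω`. -/
def IsC1Closure (Ω : Set (Sp d)) (g : Sp d → ℝ) : Prop :=
  ContinuousOn g (closure Ω) ∧ ContDiffOn ℝ 1 g Ω ∧
    ∀ i, ∃ G : Sp d → ℝ, ContinuousOn G (closure Ω) ∧ EqOn (pd i g) G Ω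

/-- The coefficients `a_{ij} = a_{ji} ∈ C¹(Ω̄)`, `b_j, c ∈ C(Ω̄)` of a uniformly elliptic operator on
a bounded domain `Ω` with smooth boundary. -/
structure Coeffs (d : ℕ) (Ω : Set (Sp d)) where
  dom : IsSmoothBoundedDomain Ω
  a : Fin d → Fin d → Sp d → ℝ
  b : Fin d → Sp d → ℝ
  c : Sp d → ℝ
  a_symm : ∀ i j, ∀ x ∈ closure Ω, a i j x = a j i x
  a_C1 : ∀ i j, IsC1Closure Ω (a i j)
  b_cont : ∀ j, ContinuousOn (b j) (closure Ω)
  c_cont : ContinuousOn c (closure Ω)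
  elliptic : ∃ κ : ℝ, 0 < κ ∧ ∀ x ∈ Ω, ∀ ξ : Fin d → ℝ,
    κ * ∑ j, |ξ j| ^ 2 ≤ ∑ i, ∑ j, a i j x * ξ i * ξ j

theorem memLp_top_of_continuousOn {Ω : Set (Sp d)} (hΩ : IsSmoothBoundedDomain Ω)
    {g G : Sp d → ℝ} (hG : ContinuousOn G (closure Ω)) (h : EqOn g G Ω) :
    MemLp g ⊤ (volume.restrict Ω) := by
  have hcomp : IsCompact (closure Ω) := hΩ.isBounded.isCompact_closure
  obtain ⟨C, hC⟩ := hcomp.exists_bound_of_continuousOn hG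
  have hm : MeasurableSet Ω := hΩ.isOpen.measurableSet
  have hGm : MemLp G ⊤ (volume.restrict Ω) := by
    refine memLp_top_of_bound ((hG.mono subset_closure).aestronglyMeasurable hm) C ?_
    filter_upwards [ae_restrict_mem hm] with x hx
    exact hC x (subset_closure hx)
  refine hGm.ae_eq ?_
  filter_upwards [ae_restrict_mem hm] with x hx
  exact (h hx).symm

theorem Coeffs.memLp_a {Ω : Set (Sp d)} (L : Coeffs d Ω) (i j : Fin d) :
    MemLp (L.a i j) ⊤ (volume.restrict Ω) :=
  memLp_top_of_continuousOn L.dom (L.a_C1 i j).1 fun _ _ => rfl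

theorem Coeffs.memLp_pd_a {Ω : Set (Sp d)} (L : Coeffs d Ω) (k i j : Fin d) :
    MemLp (pd k (L.a i j)) ⊤ (volume.restrict Ω) := by
  obtain ⟨G, hG, h⟩ := (L.a_C1 i j).2.2 k
  exact memLp_top_of_continuousOn L.dom hG h

theorem Coeffs.memLp_b {Ω : Set (Sp d)} (L : Coeffs d Ω) (j : Fin d) :
    MemLp (L.b j) ⊤ (volume.restrict Ω) :=
  memLp_top_of_continuousOn L.dom (L.b_cont j) fun _ _ => rfl

theorem Coeffs.memLp_c {Ω : Set (Sp d)} (L : Coeffs d Ω) :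
    MemLp L.c ⊤ (volume.restrict Ω) :=
  memLp_top_of_continuousOn L.dom L.c_cont fun _ _ => rfl

/-- Multiplication by a bounded function on `L²(Ω)`. -/
def mulOp {Ω : Set (Sp d)} {g : Sp d → ℝ} (hg : MemLp g ⊤ (volume.restrict Ω)) :
    L2Ω Ω →L[ℝ] L2Ω Ω :=
  (ContinuousLinearMap.mul ℝ ℝ).holderL (volume.restrict Ω) ⊤ 2 2 (hg.toLp g)

theorem mulOp_apply {Ω : Set (Sp d)} {g : Sp d → ℝ} (hg : MemLp g ⊤ (volume.restrict Ω))
    (v : L2Ω Ω) : mulOp hg v =ᵐ[volume.restrict Ω] fun x => g x * v x := by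
  have h := (ContinuousLinearMap.mul ℝ ℝ).coeFn_holder (r := 2) (hg.toLp g) v
  filter_upwards [h, hg.coeFn_toLp] with x h1 h2
  exact h1.trans (by rw [h2]; rfl)

/-- The elliptic operator `A v = -∑_{i,j} ∂_j(a_{ij} ∂_i v) + ∑_j b_j ∂_j v + c v` as a bounded
operator from `H²(Ω) ∩ H¹₀(Ω)` to `L²(Ω)`, where
`∂_j(a_{ij} ∂_i v) = (∂_j a_{ij}) ∂_i v + a_{ij} ∂_j ∂_i v`. -/
def Coeffs.op {Ω : Set (Sp d)} (L : Coeffs d Ω) : H2H10 Ω →L[ℝ] L2Ω Ω :=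
  -(∑ i, ∑ j, (mulOp (L.memLp_pd_a j i j) ∘L jet Ω (j1 i) +
      mulOp (L.memLp_a i j) ∘L jet Ω (j2 i j))) +
    (∑ j, mulOp (L.memLp_b j) ∘L jet Ω (j1 j)) + mulOp L.memLp_c ∘L jet Ω j0

end Space

/-! ## The singular and the regular problem -/

section Problems

variable {d : ℕ} {Ω : Set (Sp d)}

/-- Multiplication of a scalar by `f ∈ L²(Ω)`, `r ↦ r f`. -/
def scalarMul (f : L2Ω Ω) : ℝ →L[ℝ] L2Ω Ω := ContinuousLinearMap.toSpanSingleton ℝ f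

/-- `u ∈ L²(0,T;L²(Ω))` lies in `^{-β}H(0,T;H²(Ω) ∩ H¹₀(Ω))`, as its element `U`, and satisfies
`(∂_t^α + A) u = μ f` in `^{-β}H(0,T;L²(Ω))`. -/
def IsSingularSolution (L : Coeffs d Ω) {T α β : ℝ} (hαβ : α ≤ β) (μ : NegH T β ℝ) (f : L2Ω Ω)
    (u : L2T T (L2Ω Ω)) : Prop :=
  ∃ U : NegH T β (H2H10 Ω), negMap (toL2Ω Ω) U = negOfL2 β u ∧
    ∃ z : NegH T α (L2Ω Ω), IsCaputo u z ∧
      negIncl hαβ z + negMap L.op U = negMap (scalarMul f) μ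

/-- `v` lies in `L²(0,T;H²(Ω) ∩ H¹₀(Ω))`, as its element `V`, and satisfies
`(∂_t^α + A) v = g f` in `L²(0,T;L²(Ω))`; in particular `∂_t^α v = z` lies in `L²(0,T;L²(Ω))`. -/
def IsRegularSolution (L : Coeffs d Ω) {T : ℝ} (α : ℝ) (g : L2T T ℝ) (f : L2Ω Ω)
    (v : L2T T (L2Ω Ω)) : Prop :=
  ∃ V : L2T T (H2H10 Ω), (toL2Ω Ω).compLp V = v ∧
    ∃ z : L2T T (L2Ω Ω), IsCaputo v (negOfL2 α z) ∧
      z + L.op.compLp V = (scalarMul f).compLp g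

end Problems

end FracDiff

end

/-! ### Truncated powers and kernels of fractional Brownian type. -/

noncomputable section

namespace FracDiff

/-! The proposition follows by applying $(J^\beta)'$ to the equation. This operator commutes with
bounded operators in space, because a bounded operator passes through the integral defining
$J^\beta$ (`IsDualRL.negMap`). It commutes with $\partial_t^\alpha$ because $J^\alpha
J^\beta=J^\beta J^\alpha$ (`timeConv_comm_ae`, `IsCaputo.isDualRL`). Hence $V=(J^\beta)'U$ is the
$H^2\cap H^1_0$-valued representative of $v$, and the equation for $u$ becomes the equation for $v$
(`exists_regular_solution`). On $L^2$ the operator $(J^\beta)'$ is the forward Riemann–Liouville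
integral, by Fubini (`IsFracKernel.inner_convL2`), which places $v$ in ${}_\beta H$.

All of this rests on one analytic fact: for $1/2<\beta<1$ both fractional integrals map $L^2(0,T;X)$
boundedly into $H^\beta(0,T;X)$, with values in the closure of the $C^1$ functions vanishing at the
appropriate endpoint. Boundedness gives $(J^\beta)'$ by Riesz representation (`exists_isDualRL`).

The bound is proved without the Fourier transform. Cut the Slobodeckij seminorm off to
$|t-s|>\varepsilon$; it is then the $L^2$ norm of an integral operator in $w$ with scalar kernel
$q$. Expanding the square, only the Gram kernel $\int q(p,r)q(p,r')\,dp$ matters, so values in any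
Hilbert space are allowed (`lintegral_sq_integral_smul_le`). The kernel $k(x)=x_+^{\beta-1}$ behaves
like that of fractional Brownian motion: $\|k(\cdot+a)-k(\cdot+b)\|^2=M|a-b|^\gamma$ with
$\gamma=2\beta-1$, by scaling (`isFracKernel_posPow`). By polarization the Gram kernel is an
integral of second differences of $|\cdot|^\gamma$ against $|h|^{-2-\gamma}$ on $|h|>\varepsilon$
(`IsFracKernel.integral_truncDiff_mul`). That integral has the closed form
$\varepsilon^{-1}P(\rho/\varepsilon)$ with $\rho=r-r'$ and $P$ integrable (`truncKernel_eq`,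
`integrable_profile`). Its $L^1$ norm does not depend on $\varepsilon$, so Schur's test gives a
uniform bound, and $\varepsilon\to0$ by monotone convergence.

Membership in the closure comes from density: the convolution of a test function with the kernel is
$C^1$ and vanishes at the endpoint, and the bound carries this to all of $L^2$
(`IsFracKernel.convL2_mem_fracH`). -/

/-- The truncated power `x ↦ x_+^{β-1}`. -/
def posPow (β x : ℝ) : ℝ := if 0 < x then x ^ (β - 1) else 0

theorem measurable_posPow (β : ℝ) : Measurable (posPow β) :=
  Measurable.ite measurableSet_Ioi (by fun_prop) measurable_const

theorem posPow_of_pos {β x : ℝ} (hx : 0 < x) : posPow β x = x ^ (β - 1) := if_pos hx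

theorem posPow_of_nonpos {β x : ℝ} (hx : x ≤ 0) : posPow β x = 0 := if_neg hx.not_gt

theorem posPow_mul {β c : ℝ} (hc : 0 < c) (x : ℝ) :
    posPow β (c * x) = c ^ (β - 1) * posPow β x := by
  rcases lt_or_ge 0 x with hx | hx
  · rw [posPow_of_pos hx, posPow_of_pos (mul_pos hc hx), Real.mul_rpow hc.le hx.le]
  · rw [posPow_of_nonpos hx, posPow_of_nonpos (mul_nonpos_of_nonneg_of_nonpos hc.le hx), mul_zero]

theorem integrableOn_rpow_Ioc {r : ℝ} (hr : -1 < r) (R : ℝ) :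
    IntegrableOn (fun x : ℝ => x ^ r) (Ioc 0 R) := by
  rcases le_or_gt 0 R with h | h
  · exact (intervalIntegrable_iff_integrableOn_Ioc_of_le h).1
      (intervalIntegral.intervalIntegrable_rpow' hr)
  · simp [Ioc_eq_empty_of_le h.le]

theorem integrableOn_posPow {β : ℝ} (hβ : 0 < β) (R : ℝ) :
    IntegrableOn (posPow β) (Ioo (-R) R) := by
  have h1 : IntegrableOn (posPow β) (Ioc 0 R) :=
    (integrableOn_rpow_Ioc (by linarith : -1 < β - 1) R).congr_fun
      (fun x hx => (posPow_of_pos hx.1).symm) measurableSet_Ioc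
  have h2 : IntegrableOn (posPow β) (Iic 0) :=
    integrableOn_zero.congr_fun (fun x hx => (posPow_of_nonpos hx).symm) measurableSet_Iic
  refine (h2.union h1).mono_set fun x hx => ?_
  rcases le_or_gt x 0 with h | h
  · exact Or.inl h
  · exact Or.inr ⟨h, hx.2.le⟩

theorem posPow_sq {β : ℝ} (x : ℝ) : posPow β x ^ 2 = posPow (2 * β - 1) x := by
  rcases lt_or_ge 0 x with hx | hx
  · rw [posPow_of_pos hx, posPow_of_pos hx, ← Real.rpow_natCast, ← Real.rpow_mul hx.le]
    congr 1; push_cast; ring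
  · simp [posPow_of_nonpos hx]

/-- The square is the truncated power of parameter $2\beta-1$, which is locally integrable when this
parameter is positive; hence the restriction $\beta>1/2$. -/
theorem memLp_posPow {β : ℝ} (hβ : 1 / 2 < β) (R : ℝ) :
    MemLp (posPow β) 2 (volume.restrict (Ioo (-R) R)) := by
  rw [memLp_two_iff_integrable_sq (measurable_posPow β).aestronglyMeasurable]
  simp only [posPow_sq]
  exact integrableOn_posPow (by linarith) R

theorem abs_posPow_sub_le_left {β x : ℝ} (hβ : β < 1) (hx : 0 < x) :
    |posPow β (x + 1) - posPow β x| ≤ x ^ (β - 1) := by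
  rw [posPow_of_pos hx, posPow_of_pos (by linarith)]
  have h1 : (x + 1) ^ (β - 1) ≤ x ^ (β - 1) :=
    Real.rpow_le_rpow_of_nonpos hx (by linarith) (by linarith)
  have h2 : 0 ≤ (x + 1) ^ (β - 1) := by positivity
  rw [abs_sub_comm, abs_of_nonneg (by linarith)]
  linarith

theorem abs_posPow_sub_le_right {β x : ℝ} (hβ0 : 0 < β) (hβ : β < 1) (hx : 0 < x) :
    |posPow β (x + 1) - posPow β x| ≤ x ^ (β - 2) := by
  rw [posPow_of_pos hx, posPow_of_pos (by linarith)]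
  have hx1 : 0 < x + 1 := by linarith
  have h1 : (x + 1) ^ (β - 1) ≤ x ^ (β - 1) :=
    Real.rpow_le_rpow_of_nonpos hx (by linarith) (by linarith)
  rw [abs_sub_comm, abs_of_nonneg (by linarith)]
  -- Since $0\le x/(x+1)\le1$ and $1-\beta\le1$, raising this ratio to the power $1-\beta$ does not
  -- decrease it. Together with $1-x/(x+1)\le1/x$ this gains one power of decay.
  have h3 : x ^ (β - 1) * (x / (x + 1)) ≤ (x + 1) ^ (β - 1) := by
    have e : (x + 1) ^ (β - 1) = x ^ (β - 1) * (x / (x + 1)) ^ (1 - β) := by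
      rw [Real.div_rpow hx.le hx1.le, ← mul_div_assoc, ← Real.rpow_add hx]
      rw [show β - 1 + (1 - β) = 0 by ring, Real.rpow_zero, one_div, ← Real.rpow_neg hx1.le]
      congr 1; ring
    rw [e]
    refine mul_le_mul_of_nonneg_left ?_ (by positivity)
    exact Real.self_le_rpow_of_le_one (by positivity) ((div_le_one hx1).2 (by linarith))
      (by linarith)
  have h4 : x ^ (β - 2) = x ^ (β - 1) * (1 / x) := by
    rw [show β - 2 = β - 1 + (-1) by ring, Real.rpow_add hx, Real.rpow_neg_one, one_div]
  have h5 : 1 - x / (x + 1) ≤ 1 / x := by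
    rw [one_sub_div hx1.ne', div_le_div_iff₀ hx1 hx]; linarith
  have h6 : 0 ≤ x ^ (β - 1) := by positivity
  nlinarith [mul_le_mul_of_nonneg_left h5 h6]

/-- The singularities at $-1$ and $0$ are of order $\beta-1$, square integrable for $\beta>1/2$. At
$+\infty$ the two powers cancel to order $\beta-2$, and left of $-1$ both vanish. -/
theorem memLp_posPow_sub_one {β : ℝ} (hβ : 1 / 2 < β) (hβ1 : β < 1) :
    MemLp (fun x => posPow β (x + 1) - posPow β x) 2 volume := by
  have hm : Measurable fun x => posPow β (x + 1) - posPow β x :=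
    ((measurable_posPow β).comp (measurable_add_const 1)).sub (measurable_posPow β)
  rw [memLp_two_iff_integrable_sq hm.aestronglyMeasurable, ← integrableOn_univ]
  have key : ∀ (s : Set ℝ) (G : ℝ → ℝ), MeasurableSet s → IntegrableOn G s →
      (∀ x ∈ s, |posPow β (x + 1) - posPow β x| ^ 2 ≤ G x) →
      IntegrableOn (fun x => (posPow β (x + 1) - posPow β x) ^ 2) s := by
    intro s G hs hG h
    refine hG.mono' (hm.pow_const 2).aestronglyMeasurable ?_
    filter_upwards [ae_restrict_mem hs] with x hx
    simpa using h x hx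
  have hneg : IntegrableOn (fun x => (posPow β (x + 1) - posPow β x) ^ 2) (Iic 0) := by
    have hloc : IntegrableOn (fun x => posPow (2 * β - 1) (x + 1)) (Ioo (-3) 1) := by
      have := ((measurePreserving_add_right volume (1 : ℝ)).integrableOn_comp_preimage
        (Homeomorph.addRight 1).measurableEmbedding).2
        (integrableOn_posPow (by linarith : 0 < 2 * β - 1) 2)
      refine IntegrableOn.mono_set this fun x hx => ?_
      simp only [mem_preimage, mem_Ioo] at hx ⊢
      constructor <;> linarith [hx.1, hx.2]
    have h1 : IntegrableOn (fun x => (posPow β (x + 1) - posPow β x) ^ 2) (Ioc (-1) 0) := by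
      refine key _ _ measurableSet_Ioc (hloc.mono_set fun x hx => ?_) fun x hx => ?_
      · exact ⟨by linarith [hx.1], by linarith [hx.2]⟩
      · rw [posPow_of_nonpos hx.2, sub_zero, sq_abs, posPow_sq]
    have h2 : IntegrableOn (fun x => (posPow β (x + 1) - posPow β x) ^ 2) (Iic (-1)) := by
      refine key _ (fun _ => 0) measurableSet_Iic integrableOn_zero fun x hx => ?_
      have : x ≤ -1 := hx
      rw [posPow_of_nonpos (by linarith), posPow_of_nonpos (by linarith)]
      simp
    rw [← Iic_union_Ioc_eq_Iic (by norm_num : (-1 : ℝ) ≤ 0)]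
    exact h2.union h1
  have hmid : IntegrableOn (fun x => (posPow β (x + 1) - posPow β x) ^ 2) (Ioc 0 1) := by
    refine key _ _ measurableSet_Ioc
      (integrableOn_rpow_Ioc (by linarith : -1 < 2 * β - 2) 1) fun x hx => ?_
    refine (pow_le_pow_left₀ (abs_nonneg _) (abs_posPow_sub_le_left hβ1 hx.1) 2).trans_eq ?_
    rw [← Real.rpow_natCast, ← Real.rpow_mul hx.1.le]
    congr 1; push_cast; ring
  have htail : IntegrableOn (fun x => (posPow β (x + 1) - posPow β x) ^ 2) (Ioi 1) := by
    refine key _ _ measurableSet_Ioi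
      (integrableOn_Ioi_rpow_of_lt (by linarith : 2 * β - 4 < -1) one_pos) fun x hx => ?_
    have hx0 : 0 < x := one_pos.trans hx
    refine (pow_le_pow_left₀ (abs_nonneg _)
      (abs_posPow_sub_le_right (by linarith) hβ1 hx0) 2).trans_eq ?_
    rw [← Real.rpow_natCast, ← Real.rpow_mul hx0.le]
    congr 1; push_cast; ring
  have := (hneg.union hmid).union htail
  rwa [Iic_union_Ioc_eq_Iic zero_le_one, Iic_union_Ioi] at this

/-- A kernel of fractional Brownian type: its increments are square integrable, and the squared
norm of the increment is a multiple of `|a - b|^γ`. -/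
structure IsFracKernel (γ : ℝ) (κ : ℝ → ℝ) : Prop where
  meas : Measurable κ
  memLp_loc : ∀ R, MemLp κ 2 (volume.restrict (Ioo (-R) R))
  memLp_sub : ∀ a b, MemLp (fun x => κ (x + a) - κ (x + b)) 2 volume
  increment : ∃ M : ℝ, ∀ a b, ∫ x, (κ (x + a) - κ (x + b)) ^ 2 = M * |a - b| ^ γ

theorem memLp_comp_add_right {f : ℝ → ℝ} (hf : MemLp f 2 volume) (a : ℝ) :
    MemLp (fun x => f (x + a)) 2 volume :=
  hf.comp_measurePreserving (measurePreserving_add_right volume a)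

theorem isFracKernel_posPow {β : ℝ} (hβ : 1 / 2 < β) (hβ1 : β < 1) :
    IsFracKernel (2 * β - 1) (posPow β) := by
  -- Homogeneity reduces an increment $h$ to the unit increment: the square contributes
  -- $h^{2\beta-2}$ and the change of variables $h$, giving the exponent $2\beta-1$.
  have hscale : ∀ h : ℝ, 0 < h → ∀ x, posPow β (x + h) - posPow β x =
      h ^ (β - 1) * (posPow β (h⁻¹ * x + 1) - posPow β (h⁻¹ * x)) := by
    intro h hh x
    rw [mul_sub, ← posPow_mul hh, ← posPow_mul hh, mul_add, ← mul_assoc, mul_inv_cancel₀ hh.ne']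
    simp
  have hpos : ∀ h : ℝ, 0 < h → MemLp (fun x => posPow β (x + h) - posPow β x) 2 volume ∧
      ∫ x, (posPow β (x + h) - posPow β x) ^ 2 =
        (∫ x, (posPow β (x + 1) - posPow β x) ^ 2) * h ^ (2 * β - 1) := by
    intro h hh
    have hm : Measurable fun x => posPow β (x + h) - posPow β x :=
      ((measurable_posPow β).comp (measurable_add_const h)).sub (measurable_posPow β)
    have h1 : (fun x => (posPow β (x + h) - posPow β x) ^ 2) = fun x => (h ^ (β - 1)) ^ 2 *
        (fun y => (posPow β (y + 1) - posPow β y) ^ 2) (h⁻¹ * x) := by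
      funext x; rw [hscale h hh x]; ring
    constructor
    · rw [memLp_two_iff_integrable_sq hm.aestronglyMeasurable, h1]
      exact ((memLp_posPow_sub_one hβ hβ1).integrable_sq.comp_mul_left'
        (inv_ne_zero hh.ne')).const_mul _
    · rw [h1, integral_const_mul, Measure.integral_comp_mul_left
        (fun y => (posPow β (y + 1) - posPow β y) ^ 2) h⁻¹, inv_inv, abs_of_pos hh,
        smul_eq_mul, ← mul_assoc, mul_comm]
      congr 1
      rw [← Real.rpow_natCast, ← Real.rpow_mul hh.le]
      nth_rewrite 2 [← Real.rpow_one h]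
      rw [← Real.rpow_add hh]
      congr 1; push_cast; ring
  have hlt : ∀ a b : ℝ, b < a → MemLp (fun x => posPow β (x + a) - posPow β (x + b)) 2 volume ∧
      ∫ x, (posPow β (x + a) - posPow β (x + b)) ^ 2 =
        (∫ x, (posPow β (x + 1) - posPow β x) ^ 2) * |a - b| ^ (2 * β - 1) := by
    intro a b hab
    obtain ⟨h1, h2⟩ := hpos (a - b) (sub_pos.2 hab)
    have e : ∀ x, x + b + (a - b) = x + a := fun x => by ring
    constructor
    · simpa only [e] using memLp_comp_add_right h1 b
    · have := integral_add_right_eq_self (μ := volume)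
        (fun x => (posPow β (x + (a - b)) - posPow β x) ^ 2) b
      simp only [e] at this
      rw [this, h2, abs_of_pos (sub_pos.2 hab)]
  refine ⟨measurable_posPow β, memLp_posPow hβ, fun a b => ?_,
    ⟨∫ x, (posPow β (x + 1) - posPow β x) ^ 2, fun a b => ?_⟩⟩
  · rcases lt_trichotomy a b with h | rfl | h
    · convert (hlt b a h).1.neg using 1
      funext x; simp
    · simp
    · exact (hlt a b h).1
  · rcases lt_trichotomy a b with h | rfl | h
    · rw [abs_sub_comm, ← (hlt b a h).2]
      refine integral_congr_ae (Eventually.of_forall fun x => ?_)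
      dsimp only; ring
    · simp [Real.zero_rpow (by linarith : 2 * β - 1 ≠ 0)]
    · exact (hlt a b h).2

theorem IsFracKernel.const_mul {γ : ℝ} {κ : ℝ → ℝ} (hκ : IsFracKernel γ κ) (c : ℝ) :
    IsFracKernel γ (fun x => c * κ x) := by
  obtain ⟨M, hM⟩ := hκ.increment
  refine ⟨hκ.meas.const_mul c, fun R => (hκ.memLp_loc R).const_mul c, fun a b => ?_,
    ⟨c ^ 2 * M, fun a b => ?_⟩⟩
  · simpa only [mul_sub] using (hκ.memLp_sub a b).const_mul c
  · simp only [← mul_sub, mul_pow]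
    rw [integral_const_mul, hM, mul_assoc]

theorem IsFracKernel.comp_neg {γ : ℝ} {κ : ℝ → ℝ} (hκ : IsFracKernel γ κ) :
    IsFracKernel γ (fun x => κ (-x)) := by
  obtain ⟨M, hM⟩ := hκ.increment
  have hn := Measure.measurePreserving_neg (volume : Measure ℝ)
  refine ⟨hκ.meas.comp measurable_neg, fun R => ?_, fun a b => ?_, ⟨M, fun a b => ?_⟩⟩
  · have h := hn.restrict_preimage (s := Ioo (-R) R) measurableSet_Ioo
    have e : Neg.neg ⁻¹' Ioo (-R) R = Ioo (-R) R := by simp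
    rw [e] at h
    exact (hκ.memLp_loc R).comp_measurePreserving h
  · simpa [Function.comp_def, add_comm] using
      (hκ.memLp_sub (-a) (-b)).comp_measurePreserving hn
  · have := integral_neg_eq_self (fun x => (κ (x + -a) - κ (x + -b)) ^ 2) volume
    rw [hM] at this
    simp only [neg_add]
    rw [this, show -a - -b = -(a - b) by ring, abs_neg]

/-- The covariance of increments of a kernel of fractional Brownian type, by polarization. -/
theorem IsFracKernel.covariance {γ : ℝ} {κ : ℝ → ℝ} (hκ : IsFracKernel γ κ) {M : ℝ}
    (hM : ∀ a b, ∫ x, (κ (x + a) - κ (x + b)) ^ 2 = M * |a - b| ^ γ) (a b c d : ℝ) :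
    ∫ x, (κ (x + a) - κ (x + b)) * (κ (x + c) - κ (x + d)) =
      M / 2 * (|a - d| ^ γ + |b - c| ^ γ - |a - c| ^ γ - |b - d| ^ γ) := by
  have hi := fun a b => (hκ.memLp_sub a b).integrable_sq
  have h1 : Integrable fun x => (κ (x + a) - κ (x + d)) ^ 2 + (κ (x + b) - κ (x + c)) ^ 2 :=
    (hi a d).add (hi b c)
  have h2 : Integrable fun x => (κ (x + a) - κ (x + d)) ^ 2 + (κ (x + b) - κ (x + c)) ^ 2 -
      (κ (x + a) - κ (x + c)) ^ 2 := h1.sub (hi a c)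
  calc ∫ x, (κ (x + a) - κ (x + b)) * (κ (x + c) - κ (x + d))
      = ∫ x, 1 / 2 * ((κ (x + a) - κ (x + d)) ^ 2 + (κ (x + b) - κ (x + c)) ^ 2 -
          (κ (x + a) - κ (x + c)) ^ 2 - (κ (x + b) - κ (x + d)) ^ 2) := by
        refine integral_congr_ae (Eventually.of_forall fun x => ?_)
        dsimp only; ring
    _ = _ := by
        rw [integral_const_mul, integral_sub h2 (hi b d), integral_sub h1 (hi a c), integral_add (hi a d) (hi b c)]
        simp only [hM]; ring

end FracDiff

end

/-! ### Second differences of $|\cdot|^\gamma$ and the integrable profile of their truncated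
integrals. -/

noncomputable section

namespace FracDiff

/-- The odd power `x ↦ x |x|^γ`. -/
def oddPow (γ x : ℝ) : ℝ := x * |x| ^ γ

theorem oddPow_neg (γ x : ℝ) : oddPow γ (-x) = -oddPow γ x := by simp [oddPow]

theorem oddPow_zero (γ : ℝ) : oddPow γ 0 = 0 := by simp [oddPow]

theorem measurable_oddPow (γ : ℝ) : Measurable (oddPow γ) := by unfold oddPow; fun_prop

/-- The odd power serves as an antiderivative of $|x|^\gamma$, up to the factor $1+\gamma$, on the
whole line including the origin. -/
theorem hasDerivAt_oddPow {γ : ℝ} (hγ : 0 < γ) (x : ℝ) :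
    HasDerivAt (oddPow γ) ((1 + γ) * |x| ^ γ) x := by
  rcases eq_or_ne x 0 with rfl | hx
  · rw [hasDerivAt_iff_tendsto_slope]
    have h1 : Tendsto (fun y : ℝ => |y| ^ γ) (𝓝 0) (𝓝 (|0| ^ γ)) :=
      (continuous_abs.rpow_const fun _ => Or.inr hγ.le).tendsto 0
    rw [abs_zero, Real.zero_rpow hγ.ne'] at h1 ⊢
    rw [mul_zero]
    refine (h1.mono_left nhdsWithin_le_nhds).congr' ?_
    filter_upwards [self_mem_nhdsWithin] with y hy
    have hy' : y ≠ 0 := hy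
    simp only [slope_def_field, oddPow, zero_mul, sub_zero]
    field_simp
  · have hx' : 0 < |x| := abs_pos.2 hx
    have h : HasDerivAt (oddPow γ)
        (1 * |x| ^ γ + x * ((SignType.sign x : ℝ) * γ * |x| ^ (γ - 1))) x :=
      (hasDerivAt_id x).mul ((hasDerivAt_abs hx).rpow_const (p := γ) (Or.inl hx'.ne'))
    refine h.congr_deriv ?_
    have h1 : x * SignType.sign x = |x| := by rw [mul_comm]; exact sign_mul_self x
    have h2 : |x| ^ γ = |x| * |x| ^ (γ - 1) := by
      nth_rewrite 2 [← Real.rpow_one |x|]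
      rw [← Real.rpow_add hx']; congr 1; ring
    rw [show x * ((SignType.sign x : ℝ) * γ * |x| ^ (γ - 1)) =
      (x * (SignType.sign x : ℝ)) * γ * |x| ^ (γ - 1) by ring, h1, h2]
    ring

/-- The second difference `|ρ+h|^γ + |ρ-h|^γ - 2|ρ|^γ`. -/
def secondDiff (γ ρ h : ℝ) : ℝ := |ρ + h| ^ γ + |ρ - h| ^ γ - 2 * |ρ| ^ γ

theorem measurable_secondDiff (γ ρ : ℝ) : Measurable (secondDiff γ ρ) := by
  unfold secondDiff; fun_prop

theorem secondDiff_abs (γ ρ h : ℝ) : secondDiff γ ρ |h| = secondDiff γ ρ h := by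
  rcases abs_choice h with e | e <;> rw [e]
  simp only [secondDiff, sub_neg_eq_add, ← sub_eq_add_neg]; ring

theorem abs_abs_rpow_sub_le {γ : ℝ} (h0 : 0 ≤ γ) (h1 : γ ≤ 1) (a b : ℝ) :
    |(|a| ^ γ - |b| ^ γ)| ≤ |a - b| ^ γ := by
  have key : ∀ a b : ℝ, |a| ^ γ - |b| ^ γ ≤ |a - b| ^ γ := by
    intro a b
    have h : |a| ≤ |a - b| + |b| := by
      have := abs_add_le (a - b) b; rwa [sub_add_cancel] at this
    have := (Real.rpow_le_rpow (abs_nonneg a) h h0).trans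
      (Real.rpow_add_le_add_rpow (abs_nonneg _) (abs_nonneg _) h0 h1)
    linarith
  refine abs_le.2 ⟨?_, key a b⟩
  have := key b a
  rw [abs_sub_comm] at this
  linarith

/-- Subadditivity of $x\mapsto x^\gamma$ for $\gamma\le1$. Against the weight $h^{-2-\gamma}$ it
leaves $h^{-2}$, integrable away from zero. -/
theorem abs_secondDiff_le {γ : ℝ} (h0 : 0 ≤ γ) (h1 : γ ≤ 1) (ρ h : ℝ) :
    |secondDiff γ ρ h| ≤ 2 * |h| ^ γ := by
  have e1 := abs_abs_rpow_sub_le h0 h1 (ρ + h) ρ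
  have e2 := abs_abs_rpow_sub_le h0 h1 (ρ - h) ρ
  rw [show ρ + h - ρ = h by ring] at e1
  rw [show ρ - h - ρ = -h by ring, abs_neg] at e2
  have := abs_add_le (|ρ + h| ^ γ - |ρ| ^ γ) (|ρ - h| ^ γ - |ρ| ^ γ)
  rw [show |ρ + h| ^ γ - |ρ| ^ γ + (|ρ - h| ^ γ - |ρ| ^ γ) = secondDiff γ ρ h by
    simp only [secondDiff]; ring] at this
  linarith

theorem integrableOn_rpow_mul_secondDiff {γ : ℝ} (h0 : 0 < γ) (h1 : γ ≤ 1) {ε : ℝ} (hε : 0 < ε)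
    (ρ : ℝ) : IntegrableOn (fun h => h ^ (-(2 + γ)) * secondDiff γ ρ h) (Ioi ε) := by
  have hb : IntegrableOn (fun h : ℝ => 2 * h ^ (-2 : ℝ)) (Ioi ε) :=
    (integrableOn_Ioi_rpow_of_lt (by norm_num) hε).const_mul 2
  refine hb.mono' (Measurable.aestronglyMeasurable
    ((by fun_prop : Measurable fun h : ℝ => h ^ (-(2 + γ))).mul (measurable_secondDiff γ ρ))) ?_
  filter_upwards [ae_restrict_mem measurableSet_Ioi] with h hh
  have hh0 : 0 < h := hε.trans hh
  have hp : 0 ≤ h ^ (-(2 + γ)) := by positivity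
  rw [norm_mul, Real.norm_eq_abs, Real.norm_eq_abs, abs_of_nonneg hp]
  have := mul_le_mul_of_nonneg_left (abs_secondDiff_le h0.le h1 ρ h) hp
  refine this.trans_eq ?_
  rw [abs_of_pos hh0, mul_left_comm, ← Real.rpow_add hh0]
  congr 2; ring

/-- The profile of the truncated kernels. -/
def profile (γ u : ℝ) : ℝ :=
  2 / ((1 + γ) * u) * (oddPow γ (1 + u) - oddPow γ (1 - u) - 2 * oddPow γ u)

theorem measurable_profile (γ : ℝ) : Measurable (profile γ) := by
  have := measurable_oddPow γ
  unfold profile; fun_prop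

/-- With $x=\rho/h$ the integrand is $h^{-2}\big(|1+x|^\gamma+|1-x|^\gamma-2|x|^\gamma\big)$ and
$dx=-\rho h^{-2}dh$, so odd powers give an explicit antiderivative. It tends to $0$ as $h\to\infty$,
that is, as $x\to0$. -/
theorem integral_rpow_mul_secondDiff {γ : ℝ} (h0 : 0 < γ) (h1 : γ ≤ 1) {ε : ℝ} (hε : 0 < ε)
    {ρ : ℝ} (hρ : ρ ≠ 0) :
    2 * ∫ h in Ioi ε, h ^ (-(2 + γ)) * secondDiff γ ρ h = ε⁻¹ * profile γ (ρ / ε) := by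
  set E : ℝ → ℝ := fun h => -(1 / ((1 + γ) * ρ)) *
    (oddPow γ (1 + ρ * h⁻¹) - oddPow γ (1 - ρ * h⁻¹) - 2 * oddPow γ (ρ * h⁻¹)) with hE
  have hγ : 1 + γ ≠ 0 := by positivity
  have hderiv : ∀ h ∈ Ici ε, HasDerivAt E (h ^ (-(2 + γ)) * secondDiff γ ρ h) h := by
    intro h hh
    have hh0 : 0 < h := hε.trans_le hh
    have d0 : HasDerivAt (fun h : ℝ => ρ * h⁻¹) (ρ * (-(h ^ 2)⁻¹)) h :=
      (hasDerivAt_inv hh0.ne').const_mul ρ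
    have d1 := (hasDerivAt_oddPow h0 (1 + ρ * h⁻¹)).comp h (d0.const_add 1)
    have d2 := (hasDerivAt_oddPow h0 (1 - ρ * h⁻¹)).comp h (d0.const_sub 1)
    have d3 := ((hasDerivAt_oddPow h0 (ρ * h⁻¹)).comp h d0).const_mul 2
    have d := ((d1.sub d2).sub d3).const_mul (-(1 / ((1 + γ) * ρ)))
    have hpow : ∀ x : ℝ, h ^ (-(2 + γ)) * |x * h| ^ γ = (h ^ 2)⁻¹ * |x| ^ γ := by
      intro x
      rw [abs_mul, abs_of_pos hh0, Real.mul_rpow (abs_nonneg x) hh0.le, mul_left_comm, mul_comm,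
        ← Real.rpow_add hh0, ← Real.rpow_natCast, ← Real.rpow_neg hh0.le]
      congr 2; push_cast; ring
    have e1 := hpow (1 + ρ * h⁻¹)
    have e2 := hpow (1 - ρ * h⁻¹)
    have e3 := hpow (ρ * h⁻¹)
    rw [show (1 + ρ * h⁻¹) * h = ρ + h by field_simp; ring] at e1
    rw [show (1 - ρ * h⁻¹) * h = -(ρ - h) by field_simp; ring, abs_neg] at e2
    rw [show ρ * h⁻¹ * h = ρ by field_simp] at e3
    refine d.congr_deriv ?_
    have e4 : h ^ (-(2 + γ)) * secondDiff γ ρ h = h ^ (-(2 + γ)) * |ρ + h| ^ γ +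
        h ^ (-(2 + γ)) * |ρ - h| ^ γ - 2 * (h ^ (-(2 + γ)) * |ρ| ^ γ) := by
      rw [secondDiff]; ring
    rw [e4, e1, e2, e3]
    field_simp
    ring
  have hlim : Tendsto E atTop (𝓝 0) := by
    have hc : Continuous (oddPow γ) :=
      continuous_iff_continuousAt.2 fun x => (hasDerivAt_oddPow h0 x).continuousAt
    have hi : Tendsto (fun h : ℝ => ρ * h⁻¹) atTop (𝓝 0) := by
      simpa using tendsto_inv_atTop_zero.const_mul ρ
    have hG : Continuous fun x : ℝ => -(1 / ((1 + γ) * ρ)) *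
        (oddPow γ (1 + x) - oddPow γ (1 - x) - 2 * oddPow γ x) := by fun_prop
    have h := (hG.tendsto 0).comp hi
    rw [add_zero, sub_zero, sub_self, oddPow_zero, mul_zero, sub_zero, mul_zero] at h
    exact h
  rw [integral_Ioi_of_hasDerivAt_of_tendsto' hderiv
    (integrableOn_rpow_mul_secondDiff h0 h1 hε ρ) hlim]
  simp only [hE, profile, div_eq_mul_inv]
  field_simp
  ring

theorem profile_neg (γ u : ℝ) : profile γ (-u) = profile γ u := by
  simp only [profile, oddPow_neg, sub_neg_eq_add, ← sub_eq_add_neg, mul_neg, div_neg]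
  ring

/-- The factor $1/u$ is cancelled by Lipschitz bounds: for $u<2$ all arguments lie in $[-3,3]$,
where $|x|^\gamma\le3$. -/
theorem abs_profile_le_of_lt_two {γ u : ℝ} (h0 : 0 < γ) (h1 : γ ≤ 1) (hu : 0 < u) (hu2 : u < 2) :
    |profile γ u| ≤ 24 := by
  have hb : ∀ x ∈ Icc (-3 : ℝ) 3, |x| ^ γ ≤ 3 := by
    intro x hx
    calc |x| ^ γ ≤ 3 ^ γ := Real.rpow_le_rpow (abs_nonneg x) (abs_le.2 hx) h0.le
      _ ≤ 3 ^ (1 : ℝ) := Real.rpow_le_rpow_of_exponent_le (by norm_num) h1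
      _ = 3 := Real.rpow_one 3
  have hL := (convex_Icc (-3 : ℝ) 3).norm_image_sub_le_of_norm_hasDerivWithin_le
    (f := oddPow γ) (C := (1 + γ) * 3)
    (fun x _ => (hasDerivAt_oddPow h0 x).hasDerivWithinAt) (fun x hx => by
      have hp : 0 ≤ |x| ^ γ := by positivity
      rw [Real.norm_eq_abs, abs_of_nonneg (by positivity)]
      exact mul_le_mul_of_nonneg_left (hb x hx) (by positivity))
    (x := 1 - u) (y := 1 + u) ⟨by linarith, by linarith⟩ ⟨by linarith, by linarith⟩
  rw [Real.norm_eq_abs, Real.norm_eq_abs, show 1 + u - (1 - u) = 2 * u by ring,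
    abs_of_pos (by linarith : 0 < 2 * u)] at hL
  have hp : |2 * oddPow γ u| ≤ 6 * u := by
    have := hb u ⟨by linarith, by linarith⟩
    have h2 : 0 ≤ |u| ^ γ := by positivity
    rw [oddPow, abs_of_nonneg (by positivity)]
    nlinarith
  have hs := abs_sub (oddPow γ (1 + u) - oddPow γ (1 - u)) (2 * oddPow γ u)
  have hpos : 0 < 2 / ((1 + γ) * u) := by positivity
  rw [profile, abs_mul, abs_of_pos hpos, div_mul_eq_mul_div, div_le_iff₀ (by positivity)]
  nlinarith [mul_pos h0 hu]

/-- For $u\ge2$ the bracket is a genuine second difference of $x^{1+\gamma}$ centred at $u$, hence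
of order $u^{\gamma-1}$. Division by $u$ leaves $u^{\gamma-2}$, integrable at infinity for
$\gamma<1$. -/
theorem abs_profile_le_of_two_le {γ u : ℝ} (h0 : 0 < γ) (h1 : γ ≤ 1) (hu : 2 ≤ u) :
    |profile γ u| ≤ 9 * (1 + u) ^ (-(2 - γ)) := by
  have hu0 : 0 < u := by linarith
  -- The mean value theorem on $[u-1,u]$ turns the second difference into a first difference of
  -- $x^\gamma$ at $\xi$, which Bernoulli's inequality bounds by $\xi^{\gamma-1}$.
  obtain ⟨ξ, ⟨hξ1, hξ2⟩, hξ⟩ := exists_hasDerivAt_eq_slope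
    (fun x => oddPow γ (x + 1) - oddPow γ x)
    (fun x => (1 + γ) * |x + 1| ^ γ - (1 + γ) * |x| ^ γ) (by linarith : u - 1 < u)
    (fun x _ => (((hasDerivAt_oddPow h0 (x + 1)).comp_add_const x 1).sub
      (hasDerivAt_oddPow h0 x)).continuousAt.continuousWithinAt)
    (fun x _ => ((hasDerivAt_oddPow h0 (x + 1)).comp_add_const x 1).sub (hasDerivAt_oddPow h0 x))
  have hξ0 : 0 < ξ := by linarith
  have hN : oddPow γ (1 + u) - oddPow γ (1 - u) - 2 * oddPow γ u =
      (1 + γ) * ((ξ + 1) ^ γ - ξ ^ γ) := by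
    rw [abs_of_pos hξ0, abs_of_pos (by linarith : 0 < ξ + 1), sub_sub_cancel, div_one,
      sub_add_cancel] at hξ
    rw [show 1 - u = -(u - 1) by ring, oddPow_neg, add_comm 1 u, mul_sub, hξ]
    ring
  have hlow : 0 ≤ (ξ + 1) ^ γ - ξ ^ γ :=
    sub_nonneg.2 (Real.rpow_le_rpow hξ0.le (by linarith) h0.le)
  have hup : (ξ + 1) ^ γ - ξ ^ γ ≤ ξ ^ (γ - 1) := by
    have e1 : (ξ + 1) ^ γ = ξ ^ γ * (1 + ξ⁻¹) ^ γ := by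
      rw [← Real.mul_rpow hξ0.le (by positivity), mul_add, mul_one, mul_inv_cancel₀ hξ0.ne']
    have e2 : (1 + ξ⁻¹) ^ γ ≤ 1 + γ * ξ⁻¹ :=
      rpow_one_add_le_one_add_mul_self (by have := inv_pos.2 hξ0; linarith) h0.le h1
    have e3 : ξ ^ (γ - 1) = ξ ^ γ * ξ⁻¹ := by rw [Real.rpow_sub_one hξ0.ne', div_eq_mul_inv]
    have e4 : γ * ξ⁻¹ ≤ ξ⁻¹ := mul_le_of_le_one_left (by positivity) h1
    rw [e1, e3]
    have : 0 ≤ ξ ^ γ := by positivity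
    nlinarith
  -- From $u\ge2$ one has $\xi>u-1\ge(1+u)/3$.
  have hξu : ξ ^ (γ - 1) ≤ 3 * (1 + u) ^ (γ - 1) := by
    calc ξ ^ (γ - 1) ≤ ((1 + u) / 3) ^ (γ - 1) :=
          Real.rpow_le_rpow_of_nonpos (by positivity) (by linarith) (by linarith)
      _ = (1 + u) ^ (γ - 1) * 3 ^ (1 - γ) := by
          rw [Real.div_rpow (by positivity) (by norm_num), div_eq_mul_inv,
            ← Real.rpow_neg (by norm_num)]
          congr 2; ring
      _ ≤ (1 + u) ^ (γ - 1) * 3 ^ (1 : ℝ) := by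
          gcongr
          · norm_num
          · linarith
      _ = _ := by rw [Real.rpow_one, mul_comm]
  have hlast : (1 + u) ^ (-(2 - γ)) = (1 + u) ^ (γ - 1) / (1 + u) := by
    rw [← Real.rpow_sub_one (by positivity)]; congr 1; ring
  rw [profile, hN, abs_of_nonneg (by positivity), hlast, div_mul_eq_mul_div,
    ← mul_div_assoc, div_le_div_iff₀ (by positivity) (by positivity)]
  have hP : 0 ≤ (1 + u) ^ (γ - 1) := by positivity
  have hmul : ((ξ + 1) ^ γ - ξ ^ γ) * (1 + u) ≤ 3 * (1 + u) ^ (γ - 1) * (3 / 2 * u) := by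
    refine mul_le_mul (hup.trans hξu) (by linarith) (by positivity) (by positivity)
  nlinarith [mul_le_mul_of_nonneg_left hmul (by positivity : 0 ≤ 2 * (1 + γ))]

theorem integrable_profile {γ : ℝ} (h0 : 0 < γ) (h1 : γ < 1) : Integrable (profile γ) := by
  -- The constant is $216=24\cdot9$: on $(0,2)$ the profile is at most $24$ and
  -- $(1+u)^{-(2-\gamma)}\ge3^{-2}$.
  have hb : Integrable fun u : ℝ => 216 * (1 + ‖u‖) ^ (-(2 - γ)) :=
    (integrable_one_add_norm (by simp; linarith)).const_mul 216
  have hpos : ∀ u : ℝ, 0 < u → |profile γ u| ≤ 216 * (1 + u) ^ (-(2 - γ)) := by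
    intro u hu
    have hP : 0 ≤ (1 + u) ^ (-(2 - γ)) := by positivity
    rcases lt_or_ge u 2 with h | h
    · refine (abs_profile_le_of_lt_two h0 h1.le hu h).trans ?_
      have e : (1 / 9 : ℝ) ≤ (1 + u) ^ (-(2 - γ)) := by
        calc (1 / 9 : ℝ) = 3 ^ (-2 : ℝ) := by
              rw [Real.rpow_neg (by norm_num)]; norm_num
          _ ≤ 3 ^ (-(2 - γ)) := Real.rpow_le_rpow_of_exponent_le (by norm_num) (by linarith)
          _ ≤ (1 + u) ^ (-(2 - γ)) :=
              Real.rpow_le_rpow_of_nonpos (by positivity) (by linarith) (by linarith)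
      linarith
    · refine (abs_profile_le_of_two_le h0 h1.le h).trans ?_
      linarith
  refine hb.mono' (measurable_profile γ).aestronglyMeasurable ?_
  filter_upwards [compl_mem_ae_iff.2 (measure_singleton (0 : ℝ))] with u hu
  have hu0 : u ≠ 0 := hu
  rw [Real.norm_eq_abs, Real.norm_eq_abs]
  rcases hu0.lt_or_gt with h | h
  · rw [← profile_neg, abs_of_neg h]
    exact hpos (-u) (by linarith)
  · rw [abs_of_pos h]
    exact hpos u h

/-- The weight `|h|^{-(2+γ)}` truncated to `|h| > ε`. -/
def truncWeight (γ ε h : ℝ) : ℝ := if ε < |h| then |h| ^ (-(2 + γ)) else 0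

/-- The integral of the second differences against the truncated weight. -/
def truncKernel (γ ε ρ : ℝ) : ℝ := ∫ h, truncWeight γ ε h * secondDiff γ ρ h

/-- Weight and second difference are even in $h$, so the integral over the line is twice the one
over $h>\varepsilon$. -/
theorem truncKernel_eq {γ : ℝ} (h0 : 0 < γ) (h1 : γ ≤ 1) {ε : ℝ} (hε : 0 < ε) {ρ : ℝ}
    (hρ : ρ ≠ 0) : truncKernel γ ε ρ = ε⁻¹ * profile γ (ρ / ε) := by
  have h := integral_comp_abs
    (f := fun h => (if ε < h then h ^ (-(2 + γ)) else 0) * secondDiff γ ρ h)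
  rw [← integral_rpow_mul_secondDiff h0 h1 hε hρ]
  unfold truncKernel truncWeight
  simp only [secondDiff_abs] at h
  rw [h]
  congr 1
  have e : (fun h => (if ε < h then h ^ (-(2 + γ)) else 0) * secondDiff γ ρ h) =
      (Ioi ε).indicator fun h => h ^ (-(2 + γ)) * secondDiff γ ρ h := by
    funext h
    by_cases hh : ε < h <;> simp [hh]
  rw [e, setIntegral_indicator measurableSet_Ioi]
  congr 2
  exact inter_eq_right.2 (Ioi_subset_Ioi hε.le)

/-- The dilation $\rho\mapsto\varepsilon^{-1}P(\rho/\varepsilon)$ preserves the $L^1$ norm; this is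
what makes the final estimate uniform in the truncation. The point $\rho=0$, where the closed form
is not available, is a null set. -/
theorem integrable_truncKernel {γ : ℝ} (h0 : 0 < γ) (h1 : γ < 1) {ε : ℝ} (hε : 0 < ε) :
    Integrable (truncKernel γ ε) ∧
      ∫ ρ, |truncKernel γ ε ρ| = ∫ u, |profile γ u| := by
  have hae : truncKernel γ ε =ᵐ[volume] fun ρ => ε⁻¹ * profile γ (ε⁻¹ * ρ) := by
    filter_upwards [compl_mem_ae_iff.2 (measure_singleton (0 : ℝ))] with ρ hρ
    rw [truncKernel_eq h0 h1.le hε hρ, div_eq_inv_mul]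
  constructor
  · refine Integrable.congr ?_ hae.symm
    exact ((integrable_profile h0 h1).comp_mul_left' (inv_ne_zero hε.ne')).const_mul _
  · rw [integral_congr_ae (hae.mono fun ρ h => congrArg abs h)]
    simp only [abs_mul]
    rw [integral_const_mul, Measure.integral_comp_mul_left (fun u => |profile γ u|) ε⁻¹]
    simp only [inv_inv, abs_of_pos hε, abs_of_pos (inv_pos.2 hε), smul_eq_mul]
    rw [← mul_assoc, inv_mul_cancel₀ hε.ne', one_mul]

end FracDiff

end

/-! ### An $L^2$ bound for integral operators through their Gram kernel. -/

noncomputable section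

namespace FracDiff

/-- The shear $(x,y)\mapsto(x-y,y)$ preserves Lebesgue measure and turns the integrand into a
product. -/
theorem integrable_comp_sub_mul {Ψ v : ℝ → ℝ} (hΨ : Integrable Ψ) (hv : Integrable v) :
    Integrable (fun z : ℝ × ℝ => Ψ (z.1 - z.2) * v z.2) (volume.prod volume) ∧
      ∫ z : ℝ × ℝ, Ψ (z.1 - z.2) * v z.2 ∂(volume.prod volume) = (∫ x, Ψ x) * ∫ x, v x := by
  have hmp := measurePreserving_sub_prod (volume : Measure ℝ) (volume : Measure ℝ)
  have hi := hΨ.mul_prod hv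
  refine ⟨hmp.integrable_comp_of_integrable hi, ?_⟩
  rw [← integral_prod_mul]
  rw [← hmp.map_eq] at hi
  have := integral_map hmp.measurable.aemeasurable hi.aestronglyMeasurable
  rw [hmp.map_eq] at this
  exact this.symm

theorem integrable_comp_sub_mul_left {Ψ v : ℝ → ℝ} (hΨ : Integrable Ψ) (hv : Integrable v) :
    Integrable (fun z : ℝ × ℝ => Ψ (z.1 - z.2) * v z.1) (volume.prod volume) ∧
      ∫ z : ℝ × ℝ, Ψ (z.1 - z.2) * v z.1 ∂(volume.prod volume) = (∫ x, Ψ x) * ∫ x, v x := by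
  obtain ⟨h1, h2⟩ := integrable_comp_sub_mul hΨ.comp_neg hv
  have e : ∀ z : ℝ × ℝ, Ψ (-(z.1 - z.2)) * v z.2 =
    (fun z : ℝ × ℝ => Ψ (z.1 - z.2) * v z.1) z.swap := fun z => by simp
  simp only [e] at h1 h2
  refine ⟨integrable_swap_iff.1 h1, ?_⟩
  rw [integral_prod_swap (fun z : ℝ × ℝ => Ψ (z.1 - z.2) * v z.1)] at h2
  rw [h2, integral_neg_eq_self Ψ volume]

variable {X : Type*} [NormedAddCommGroup X] [InnerProductSpace ℝ X] [CompleteSpace X]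

/-- An operator with scalar kernel `q`, acting on Hilbert-space valued functions, is bounded on `L²`
if its Gram kernel `∫ q(s,r) q(s,r') ds` is a function of `r - r'` that is integrable. -/
theorem lintegral_sq_integral_smul_le {S : Type*} [MeasurableSpace S] {ν : Measure S} [SFinite ν]
    {q : S → ℝ → ℝ} (hq : Measurable (Function.uncurry q)) {C : ℝ}
    (hqL : ∀ r, MemLp (fun s => q s r) 2 ν) (hC : ∀ r, ∫ s, q s r ^ 2 ∂ν ≤ C)
    {Φ : ℝ → ℝ} (hΦ : Integrable Φ) (hqΦ : ∀ r r', ∫ s, q s r * q s r' ∂ν = Φ (r - r'))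
    {w : ℝ → X} (hw : Integrable w) (hw2 : MemLp w 2 volume)
    (hint : ∀ᵐ s ∂ν, Integrable fun r => q s r • w r) :
    ∫⁻ s, ‖∫ r, q s r • w r‖ₑ ^ 2 ∂ν ≤
      ENNReal.ofReal ((∫ x, |Φ x|) * ∫ r, ‖w r‖ ^ 2) := by
  -- The square of the norm is expanded as a double integral over $(r,r')$; integrating in $s$ first
  -- produces the Gram kernel.
  set H : S × (ℝ × ℝ) → ℝ := fun z =>
    q z.1 z.2.1 * q z.1 z.2.2 * inner ℝ (w z.2.1) (w z.2.2) with hH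
  have hHm : AEStronglyMeasurable H (ν.prod (volume.prod volume)) := by
    refine AEStronglyMeasurable.mul ?_ ?_
    · refine Measurable.aestronglyMeasurable (Measurable.mul ?_ ?_)
      · exact hq.comp (measurable_fst.prodMk (measurable_fst.comp measurable_snd))
      · exact hq.comp (measurable_fst.prodMk (measurable_snd.comp measurable_snd))
    · have : AEStronglyMeasurable (fun z : ℝ × ℝ => (inner ℝ (w z.1) (w z.2) : ℝ))
          (volume.prod volume) := hw.1.comp_fst.inner hw.1.comp_snd
      exact this.comp_snd
  -- The bound $C$ is needed only for this absolute integrability, which justifies Fubini; it does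
  -- not enter the final constant.
  have hHi : Integrable H (ν.prod (volume.prod volume)) := by
    refine (integrable_prod_iff' hHm).2 ⟨Eventually.of_forall fun y => ?_, ?_⟩
    · exact ((hqL y.1).integrable_mul (hqL y.2)).mul_const (inner ℝ (w y.1) (w y.2))
    · refine ((hw.norm.mul_prod hw.norm).const_mul C).mono'
        hHm.norm.prod_swap.integral_prod_right' (Eventually.of_forall fun y => ?_)
      rw [Real.norm_of_nonneg (integral_nonneg fun _ => norm_nonneg _)]
      have hb : ∀ s, ‖H (s, y)‖ ≤ (1 / 2 * (q s y.1 ^ 2 + q s y.2 ^ 2)) * (‖w y.1‖ * ‖w y.2‖) := by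
        intro s
        rw [hH, norm_mul]
        refine mul_le_mul ?_ (norm_inner_le_norm _ _) (norm_nonneg _) (by positivity)
        rw [Real.norm_eq_abs, abs_mul, ← sq_abs (q s y.1), ← sq_abs (q s y.2)]
        nlinarith [sq_nonneg (|q s y.1| - |q s y.2|)]
      have h1 := (hqL y.1).integrable_sq
      have h2 := (hqL y.2).integrable_sq
      calc ∫ s, ‖H (s, y)‖ ∂ν
          ≤ ∫ s, (1 / 2 * (q s y.1 ^ 2 + q s y.2 ^ 2)) * (‖w y.1‖ * ‖w y.2‖) ∂ν :=
            integral_mono_of_nonneg (Eventually.of_forall fun _ => norm_nonneg _)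
              (((h1.add h2).const_mul _).mul_const _) (Eventually.of_forall hb)
        _ = (1 / 2 * (∫ s, q s y.1 ^ 2 ∂ν + ∫ s, q s y.2 ^ 2 ∂ν)) * (‖w y.1‖ * ‖w y.2‖) := by
            rw [integral_mul_const, integral_const_mul, integral_add h1 h2]
        _ ≤ C * (‖w y.1‖ * ‖w y.2‖) := by
            refine mul_le_mul_of_nonneg_right ?_ (by positivity)
            linarith [hC y.1, hC y.2]
  have hsq : ∀ᵐ s ∂ν, ∫ y : ℝ × ℝ, H (s, y) ∂(volume.prod volume) =
      ‖∫ r, q s r • w r‖ ^ 2 := by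
    filter_upwards [hint] with s hs
    rw [← real_inner_self_eq_norm_sq]
    refine Eq.trans ?_ (integral_prod_bilin (innerSL ℝ : X →L[ℝ] X →L[ℝ] ℝ) hs hs)
    refine integral_congr_ae (Eventually.of_forall fun y => ?_)
    change _ = inner ℝ (q s y.1 • w y.1) (q s y.2 • w y.2)
    simp only [hH, real_inner_smul_left, real_inner_smul_right]
    ring
  have hsqi : Integrable (fun s => ‖∫ r, q s r • w r‖ ^ 2) ν :=
    hHi.integral_prod_left.congr hsq
  -- Schur's test: $|\langle w(r),w(r')\rangle|\le\frac12(\|w(r)\|^2+\|w(r')\|^2)$, and each half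
  -- integrates to $\|\Phi\|_{L^1}\|w\|_{L^2}^2$.
  have hbound : ∫ s, ‖∫ r, q s r • w r‖ ^ 2 ∂ν ≤ (∫ x, |Φ x|) * ∫ r, ‖w r‖ ^ 2 := by
    have hw2i : Integrable fun r => ‖w r‖ ^ 2 := hw2.integrable_norm_pow (by norm_num)
    obtain ⟨a1, a2⟩ := integrable_comp_sub_mul hΦ.abs hw2i
    obtain ⟨b1, b2⟩ := integrable_comp_sub_mul_left hΦ.abs hw2i
    have hi : Integrable (fun y : ℝ × ℝ => 1 / 2 *
        (|Φ (y.1 - y.2)| * ‖w y.1‖ ^ 2 + |Φ (y.1 - y.2)| * ‖w y.2‖ ^ 2))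
        (volume.prod volume) := (b1.add a1).const_mul (1 / 2)
    calc ∫ s, ‖∫ r, q s r • w r‖ ^ 2 ∂ν
        = ∫ s, ∫ y : ℝ × ℝ, H (s, y) ∂(volume.prod volume) ∂ν := integral_congr_ae
          (hsq.mono fun s hs => hs.symm)
      _ = ∫ y : ℝ × ℝ, ∫ s, H (s, y) ∂ν ∂(volume.prod volume) := integral_integral_swap hHi
      _ = ∫ y : ℝ × ℝ, Φ (y.1 - y.2) * inner ℝ (w y.1) (w y.2) ∂(volume.prod volume) := by
          refine integral_congr_ae (Eventually.of_forall fun y => ?_)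
          simp only [hH]
          rw [integral_mul_const, hqΦ]
      _ ≤ ∫ y : ℝ × ℝ, 1 / 2 * (|Φ (y.1 - y.2)| * ‖w y.1‖ ^ 2 + |Φ (y.1 - y.2)| * ‖w y.2‖ ^ 2)
            ∂(volume.prod volume) := by
          refine (Real.le_norm_self _).trans (norm_integral_le_of_norm_le hi
            (Eventually.of_forall fun y => ?_))
          rw [norm_mul, Real.norm_eq_abs]
          refine (mul_le_mul_of_nonneg_left (norm_inner_le_norm _ _) (abs_nonneg _)).trans ?_
          nlinarith [mul_nonneg (abs_nonneg (Φ (y.1 - y.2))) (sq_nonneg (‖w y.1‖ - ‖w y.2‖))]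
      _ = _ := by
          rw [integral_const_mul, integral_add b1 a1, a2, b2]; ring
  refine le_trans (le_of_eq ?_) (ENNReal.ofReal_le_ofReal hbound)
  rw [ofReal_integral_eq_lintegral_ofReal hsqi (Eventually.of_forall fun s => by positivity)]
  refine lintegral_congr fun s => ?_
  rw [ENNReal.ofReal_pow (norm_nonneg _), ofReal_norm]

end FracDiff

end

/-! ### The Slobodeckij seminorm of a convolution with a fractional kernel. -/

noncomputable section

namespace FracDiff

theorem measurable_truncWeight (γ ε : ℝ) : Measurable (truncWeight γ ε) :=
  Measurable.ite (measurableSet_lt measurable_const (by fun_prop)) (by fun_prop) measurable_const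

theorem truncWeight_nonneg (γ ε h : ℝ) : 0 ≤ truncWeight γ ε h := by
  unfold truncWeight; split_ifs <;> positivity

/-- The product is $|h|^{-2}$ cut off to $|h|>\varepsilon$, comparable there to $(1+|h|)^{-2}$. -/
theorem integrable_truncWeight_mul {γ ε : ℝ} (hε : 0 < ε) :
    Integrable fun h => truncWeight γ ε h * |h| ^ γ := by
  have hb : Integrable fun h : ℝ => (1 + 1 / ε) ^ 2 * (1 + ‖h‖) ^ (-(2 : ℝ)) :=
    (integrable_one_add_norm (by simp)).const_mul _
  refine hb.mono' ((measurable_truncWeight γ ε).mul (by fun_prop)).aestronglyMeasurable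
    (Eventually.of_forall fun h => ?_)
  unfold truncWeight
  split_ifs with hh
  · have hh0 : 0 < |h| := hε.trans hh
    rw [← Real.rpow_add hh0, show -(2 + γ) + γ = -2 by ring, Real.norm_eq_abs, Real.norm_eq_abs,
      abs_of_nonneg (by positivity)]
    have e : 1 + |h| ≤ (1 + 1 / ε) * |h| := by
      have : 1 ≤ 1 / ε * |h| := by rw [one_div, ← div_eq_inv_mul, one_le_div hε]; exact hh.le
      linarith
    rw [Real.rpow_neg hh0.le, Real.rpow_neg (by positivity), ← div_eq_mul_inv,
      le_div_iff₀ (by positivity), ← div_eq_inv_mul, div_le_iff₀ (by positivity)]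
    norm_cast
    rw [← mul_pow]
    exact pow_le_pow_left₀ (by positivity) e 2
  · rw [zero_mul, norm_zero]; positivity

/-- The truncated difference quotients of the translates of a kernel. -/
def truncDiff (κ : ℝ → ℝ) (β ε : ℝ) (p : ℝ × ℝ) (r : ℝ) : ℝ :=
  (if ε < |p.1 - p.2| then |p.1 - p.2| ^ (-(1 / 2 + β)) else 0) * (κ (p.1 - r) - κ (p.2 - r))

theorem measurable_truncDiff {κ : ℝ → ℝ} (hκ : Measurable κ) (β ε : ℝ) :
    Measurable (Function.uncurry (truncDiff κ β ε)) := by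
  unfold truncDiff Function.uncurry
  refine Measurable.mul (Measurable.ite (measurableSet_lt measurable_const ?_) ?_
    measurable_const) ?_ <;> fun_prop

/-- In the coordinates $(t,h)$ with $s=t+h$ the weight depends on $h$ alone, so the $t$-integral of
the product is a covariance of increments. The exponents match since $2(1/2+\beta)=2+(2\beta-1)$. -/
theorem truncDiff_mul_shear (κ : ℝ → ℝ) (β ε : ℝ) (t h r r' : ℝ) :
    truncDiff κ β ε (t, t + h) r * truncDiff κ β ε (t, t + h) r' =
      truncWeight (2 * β - 1) ε h *
        ((κ (t + -r) - κ (t + (h - r))) * (κ (t + -r') - κ (t + (h - r')))) := by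
  have e : |t - (t + h)| = |h| := by rw [show t - (t + h) = -h by ring, abs_neg]
  simp only [truncDiff, truncWeight, e, ← sub_eq_add_neg, show ∀ a, t + (h - a) = t + h - a from
    fun a => by ring]
  split_ifs with hh
  · rcases eq_or_ne h 0 with rfl | h0
    · simp
    have hh0 : 0 < |h| := abs_pos.2 h0
    have : |h| ^ (-(2 + (2 * β - 1))) = |h| ^ (-(1 / 2 + β)) * |h| ^ (-(1 / 2 + β)) := by
      rw [← Real.rpow_add hh0]; congr 1; ring
    rw [this]; ring
  · simp

/-- Integrating the square in $t$ gives $M|h|^{2\beta-1}$ times the weight, which the cutoff makes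
integrable in $h$. -/
theorem IsFracKernel.memLp_truncDiff {β : ℝ} {κ : ℝ → ℝ} (hκ : IsFracKernel (2 * β - 1) κ)
    {ε : ℝ} (hε : 0 < ε) (r : ℝ) :
    MemLp (fun p => truncDiff κ β ε p r) 2 (volume.prod volume) := by
  have hm : Measurable fun p => truncDiff κ β ε p r :=
    (measurable_truncDiff hκ.meas β ε).comp measurable_prodMk_right
  have hmp := measurePreserving_prod_add (volume : Measure ℝ) (volume : Measure ℝ)
  obtain ⟨M, hM⟩ := hκ.increment
  rw [memLp_two_iff_integrable_sq hm.aestronglyMeasurable, ← hmp.map_eq,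
    integrable_map_measure (hm.pow_const 2).aestronglyMeasurable hmp.measurable.aemeasurable]
  have hm2 := ((hm.pow_const 2).comp hmp.measurable).aestronglyMeasurable
    (μ := volume.prod volume)
  have e : ∀ t h, ((fun p => truncDiff κ β ε p r ^ 2) ∘ fun z : ℝ × ℝ => (z.1, z.1 + z.2)) (t, h) =
      truncWeight (2 * β - 1) ε h * (κ (t + -r) - κ (t + (h - r))) ^ 2 := by
    intro t h
    simp only [Function.comp, sq, truncDiff_mul_shear]
  refine (integrable_prod_iff' hm2).2 ⟨Eventually.of_forall fun h => ?_, ?_⟩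
  · simp only [e]
    exact (hκ.memLp_sub (-r) (h - r)).integrable_sq.const_mul _
  · have e2 : ∀ h, ∫ t, ‖((fun p => truncDiff κ β ε p r ^ 2) ∘
        fun z : ℝ × ℝ => (z.1, z.1 + z.2)) (t, h)‖ =
        M * (truncWeight (2 * β - 1) ε h * |h| ^ (2 * β - 1)) := by
      intro h
      simp only [e]
      calc ∫ t, ‖truncWeight (2 * β - 1) ε h * (κ (t + -r) - κ (t + (h - r))) ^ 2‖
          = ∫ t, truncWeight (2 * β - 1) ε h * (κ (t + -r) - κ (t + (h - r))) ^ 2 :=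
            integral_congr_ae (Eventually.of_forall fun t => Real.norm_of_nonneg
              (mul_nonneg (truncWeight_nonneg _ _ _) (sq_nonneg _)))
        _ = _ := by
          rw [integral_const_mul, hM, show -r - (h - r) = -h by ring, abs_neg]; ring
    simp only [e2]
    exact (integrable_truncWeight_mul hε).const_mul M

/-- After the shear, the covariance of the increments between $-r,\,h-r$ and between $-r',\,h-r'$ is
$M/2$ times a second difference at $\rho=r-r'$. So the Gram kernel is translation invariant. -/
theorem IsFracKernel.integral_truncDiff_mul {β : ℝ} {κ : ℝ → ℝ}
    (hκ : IsFracKernel (2 * β - 1) κ) {M : ℝ}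
    (hM : ∀ a b, ∫ x, (κ (x + a) - κ (x + b)) ^ 2 = M * |a - b| ^ (2 * β - 1))
    {ε : ℝ} (hε : 0 < ε) (r r' : ℝ) :
    ∫ p, truncDiff κ β ε p r * truncDiff κ β ε p r' ∂(volume.prod volume) =
      M / 2 * truncKernel (2 * β - 1) ε (r - r') := by
  have hmp := measurePreserving_prod_add (volume : Measure ℝ) (volume : Measure ℝ)
  have hi : Integrable (fun p => truncDiff κ β ε p r * truncDiff κ β ε p r')
    (volume.prod volume) := (hκ.memLp_truncDiff hε r).integrable_mul (hκ.memLp_truncDiff hε r')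
  have hi2 := hmp.integrable_comp_of_integrable hi
  have hmap := integral_map (μ := volume.prod volume) hmp.measurable.aemeasurable
    (hmp.map_eq.symm ▸ hi.aestronglyMeasurable)
  rw [hmp.map_eq] at hmap
  rw [hmap]
  refine (integral_prod_symm _ hi2).trans ?_
  rw [truncKernel, ← integral_const_mul]
  refine integral_congr_ae (Eventually.of_forall fun h => ?_)
  simp only [Function.comp, truncDiff_mul_shear]
  rw [integral_const_mul, hκ.covariance hM, secondDiff,
    show -r - (h - r') = -(r - r' + h) by ring, show h - r - -r' = -(r - r' - h) by ring,
    show -r - -r' = -(r - r') by ring, show h - r - (h - r') = -(r - r') by ring]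
  simp only [abs_neg]
  ring

variable {X : Type*} [NormedAddCommGroup X]

/-- The convolution over `(0,T)` with a scalar kernel. -/
def timeConv [NormedSpace ℝ X] (κ : ℝ → ℝ) (T : ℝ) (w : ℝ → X) (t : ℝ) : X :=
  ∫ r in Ioo 0 T, κ (t - r) • w r

theorem timeConv_eq_integral [NormedSpace ℝ X] (κ : ℝ → ℝ) (T : ℝ) (w : ℝ → X) (t : ℝ) :
    timeConv κ T w t = ∫ r, κ (t - r) • (Ioo 0 T).indicator w r := by
  rw [timeConv, ← integral_indicator measurableSet_Ioo]
  refine integral_congr_ae (Eventually.of_forall fun r => ?_)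
  by_cases hr : r ∈ Ioo 0 T <;> simp [hr]

theorem timeConv_congr [NormedSpace ℝ X] (κ : ℝ → ℝ) {T : ℝ} {w w' : ℝ → X}
    (h : w =ᵐ[timeMeasure T] w') : timeConv κ T w = timeConv κ T w' := by
  funext t
  refine integral_congr_ae ?_
  filter_upwards [h] with r hr
  rw [hr]

theorem eLpNorm_comp_sub_le {κ : ℝ → ℝ} (hκ : Measurable κ) {T R t : ℝ}
    (h1 : -R ≤ t - T) (h2 : t ≤ R) :
    eLpNorm (fun r => κ (t - r)) 2 (timeMeasure T) ≤
      eLpNorm κ 2 (volume.restrict (Ioo (-R) R)) := by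
  have hmp := (Measure.measurePreserving_sub_left (volume : Measure ℝ) t).restrict_preimage
    (s := Ioo (-R) R) measurableSet_Ioo
  refine (eLpNorm_mono_measure _ (Measure.restrict_mono (fun r hr => ?_) le_rfl)).trans_eq
    (eLpNorm_comp_measurePreserving hκ.aestronglyMeasurable hmp)
  exact ⟨by linarith [hr.2], by linarith [hr.1]⟩

theorem IsFracKernel.memLp_comp_sub {γ : ℝ} {κ : ℝ → ℝ} (hκ : IsFracKernel γ κ) (T t : ℝ) :
    MemLp (fun r => κ (t - r)) 2 (timeMeasure T) := by
  refine ⟨(hκ.meas.comp (measurable_const.sub measurable_id)).aestronglyMeasurable, ?_⟩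
  refine (eLpNorm_comp_sub_le hκ.meas (R := max t (T - t)) ?_ (le_max_left _ _)).trans_lt
    (hκ.memLp_loc _).2
  linarith [le_max_right t (T - t)]

section

variable [NormedSpace ℝ X]

theorem IsFracKernel.integrable_smul {γ : ℝ} {κ : ℝ → ℝ} (hκ : IsFracKernel γ κ) {T : ℝ}
    {w : ℝ → X} (hw : MemLp w 2 (timeMeasure T)) (t : ℝ) :
    Integrable (fun r => κ (t - r) • w r) (timeMeasure T) :=
  memLp_one_iff_integrable.1 (hw.smul (hκ.memLp_comp_sub T t))

theorem aestronglyMeasurable_timeConv {κ : ℝ → ℝ} (hκ : Measurable κ) {T : ℝ}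
    {w : ℝ → X} (hw : AEStronglyMeasurable w (timeMeasure T)) :
    AEStronglyMeasurable (timeConv κ T w) (timeMeasure T) := by
  have h : AEStronglyMeasurable (fun z : ℝ × ℝ => κ (z.1 - z.2) • w z.2)
      ((timeMeasure T).prod (timeMeasure T)) :=
    (hκ.comp (measurable_fst.sub measurable_snd)).aestronglyMeasurable.smul hw.comp_snd
  exact h.integral_prod_right'

/-- Cauchy–Schwarz bounds the convolution pointwise in $t$; the factor $T^{1/2}$ is the cost of
passing from a supremum to an $L^2$ norm on $(0,T)$. -/
theorem eLpNorm_timeConv_le {κ : ℝ → ℝ} (hκ : Measurable κ) {T : ℝ}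
    {w : ℝ → X} (hw : AEStronglyMeasurable w (timeMeasure T)) :
    eLpNorm (timeConv κ T w) 2 (timeMeasure T) ≤
      eLpNorm κ 2 (volume.restrict (Ioo (-T) T)) * ENNReal.ofReal T ^ (2⁻¹ : ℝ) *
        eLpNorm w 2 (timeMeasure T) := by
  refine (eLpNorm_le_of_ae_enorm_bound (C := eLpNorm κ 2 (volume.restrict (Ioo (-T) T)) *
    eLpNorm w 2 (timeMeasure T)) ?_).trans_eq ?_
  · filter_upwards [ae_restrict_mem measurableSet_Ioo] with t ht
    have hm : AEStronglyMeasurable (fun r => κ (t - r)) (timeMeasure T) :=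
      (hκ.comp (measurable_const.sub measurable_id)).aestronglyMeasurable
    calc ‖timeConv κ T w t‖ₑ ≤ eLpNorm ((fun r => κ (t - r)) • w) 1 (timeMeasure T) := by
          rw [eLpNorm_one_eq_lintegral_enorm]
          exact enorm_integral_le_lintegral_enorm _
      _ ≤ eLpNorm (fun r => κ (t - r)) 2 (timeMeasure T) * eLpNorm w 2 (timeMeasure T) :=
          eLpNorm_smul_le_mul_eLpNorm hw hm
      _ ≤ _ := by
          gcongr
          exact eLpNorm_comp_sub_le hκ (by linarith [ht.1]) ht.2.le
  · rw [Measure.restrict_apply_univ, Real.volume_Ioo, sub_zero, smul_eq_mul]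
    simp only [ENNReal.toReal_ofNat]
    ring

end

variable [InnerProductSpace ℝ X] [CompleteSpace X]

/-- The central estimate. The bound on $\{|t-s|>\varepsilon\}$ does not depend on $\varepsilon$, and
these sets exhaust the complement of the diagonal. -/
theorem IsFracKernel.lintegral_diffQuot_timeConv_le {β : ℝ} {κ : ℝ → ℝ}
    (hβ : 1 / 2 < β) (hβ1 : β < 1) (hκ : IsFracKernel (2 * β - 1) κ) :
    ∃ K : ℝ, ∀ (T : ℝ) (w : ℝ → X), MemLp w 2 (timeMeasure T) →
      ∫⁻ p, ‖diffQuot β (timeConv κ T w) p‖ₑ ^ 2 ∂(volume.prod volume) ≤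
        ENNReal.ofReal (K * ∫ r in Ioo 0 T, ‖w r‖ ^ 2) := by
  obtain ⟨M, hM⟩ := hκ.increment
  have hγ0 : 0 < 2 * β - 1 := by linarith
  have hγ1 : 2 * β - 1 < 1 := by linarith
  refine ⟨|M / 2| * ∫ u, |profile (2 * β - 1) u|, fun T w hw => ?_⟩
  set w' := (Ioo 0 T).indicator w with hw'
  have hw2 : MemLp w' 2 volume := (memLp_indicator_iff_restrict measurableSet_Ioo).2 hw
  have hw1 : Integrable w' :=
    (integrable_indicator_iff measurableSet_Ioo).2 (hw.integrable (by norm_num))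
  have hwint : ∫ r, ‖w' r‖ ^ 2 = ∫ r in Ioo 0 T, ‖w r‖ ^ 2 := by
    rw [← integral_indicator measurableSet_Ioo]
    refine integral_congr_ae (Eventually.of_forall fun r => ?_)
    by_cases hr : r ∈ Ioo 0 T <;> simp [hw', hr]
  have hsi : ∀ t, Integrable fun r => κ (t - r) • w' r := by
    intro t
    have := (integrable_indicator_iff measurableSet_Ioo).2 (hκ.integrable_smul hw t)
    refine this.congr (Eventually.of_forall fun r => ?_)
    by_cases hr : r ∈ Ioo 0 T <;> simp [hw', hr]
  have hq : ∀ (ε : ℝ) (p : ℝ × ℝ), truncDiff κ β ε p = fun r =>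
      (if ε < |p.1 - p.2| then |p.1 - p.2| ^ (-(1 / 2 + β)) else 0) *
        (κ (p.1 - r) - κ (p.2 - r)) := fun _ _ => rfl
  have hqint : ∀ ε p, Integrable fun r => truncDiff κ β ε p r • w' r := by
    intro ε p
    simp only [hq, mul_smul, sub_smul]
    exact ((hsi p.1).sub (hsi p.2)).smul
      (if ε < |p.1 - p.2| then |p.1 - p.2| ^ (-(1 / 2 + β)) else 0)
  have hqeq : ∀ ε (p : ℝ × ℝ), ε < |p.1 - p.2| → ∫ r, truncDiff κ β ε p r • w' r =
      diffQuot β (timeConv κ T w) p := by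
    intro ε p hp
    simp only [hq, mul_smul, sub_smul, if_pos hp]
    rw [integral_smul, integral_sub (hsi p.1) (hsi p.2), diffQuot, timeConv_eq_integral,
      timeConv_eq_integral]
  have htrunc : ∀ ε : ℝ, 0 < ε → ∫⁻ p in {p : ℝ × ℝ | ε < |p.1 - p.2|},
      ‖diffQuot β (timeConv κ T w) p‖ₑ ^ 2 ∂(volume.prod volume) ≤
        ENNReal.ofReal ((|M / 2| * ∫ u, |profile (2 * β - 1) u|) *
          ∫ r in Ioo 0 T, ‖w r‖ ^ 2) := by
    intro ε hε
    obtain ⟨hk1, hk2⟩ := integrable_truncKernel hγ0 hγ1 hε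
    have hms : MeasurableSet {p : ℝ × ℝ | ε < |p.1 - p.2|} :=
      measurableSet_lt measurable_const (by fun_prop)
    -- The auxiliary bound on $\int q(p,r)^2\,dp$ is the Gram kernel on its diagonal, hence constant
    -- in $r$.
    have key := lintegral_sq_integral_smul_le (ν := volume.prod volume)
      (measurable_truncDiff hκ.meas β ε) (C := M / 2 * truncKernel (2 * β - 1) ε 0)
      (hκ.memLp_truncDiff hε)
      (fun r => by
        have := hκ.integral_truncDiff_mul hM hε r r
        rw [sub_self] at this
        simp only [sq]
        exact this.le)
      (hk1.const_mul (M / 2)) (hκ.integral_truncDiff_mul hM hε) hw1 hw2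
      (Eventually.of_forall (hqint ε))
    simp only [abs_mul] at key
    rw [integral_const_mul, hk2, hwint] at key
    refine le_trans ?_ key
    rw [setLIntegral_congr_fun hms (g := fun p => ‖∫ r, truncDiff κ β ε p r • w' r‖ₑ ^ 2)
      (fun p hp => by simp only [hqeq ε p hp])]
    exact setLIntegral_le_lintegral _ _
  set s : ℕ → Set (ℝ × ℝ) := fun n => {p | 1 / ((n : ℝ) + 1) < |p.1 - p.2|} with hs
  have hmono : Monotone s := by
    intro n m hnm p hp
    have hp' : 1 / ((n : ℝ) + 1) < |p.1 - p.2| := hp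
    exact (one_div_le_one_div_of_le (by positivity) (by gcongr)).trans_lt hp'
  -- On the diagonal the difference quotient is zero because $f(t)-f(t)=0$, so the exhausting sets
  -- cover its support.
  have hunion : Function.support (fun p => ‖diffQuot β (timeConv κ T w) p‖ₑ ^ 2) ⊆ ⋃ n, s n := by
    intro p hp
    have hne : p.1 ≠ p.2 := by
      intro h
      apply hp
      simp [diffQuot, h]
    obtain ⟨n, hn⟩ := exists_nat_one_div_lt (abs_pos.2 (sub_ne_zero.2 hne))
    exact mem_iUnion.2 ⟨n, hn⟩
  rw [← setLIntegral_eq_of_support_subset hunion,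
    setLIntegral_iUnion_of_directed _ hmono.directed_le]
  exact iSup_le fun n => htrunc _ (by positivity)

end FracDiff

end

/-! ### Convolution as an operator from $L^2$ into the closure spaces. -/

noncomputable section

namespace FracDiff

theorem eLpNorm_two_rpow {S E : Type*} [MeasurableSpace S] {ν : Measure S} [NormedAddCommGroup E]
    (f : S → E) : eLpNorm f 2 ν ^ (2 : ℝ) = ∫⁻ s, ‖f s‖ₑ ^ 2 ∂ν := by
  have := eLpNorm_nnreal_pow_eq_lintegral (f := f) (μ := ν) (two_ne_zero : (2 : ℝ≥0) ≠ 0)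
  simpa using this

section

variable {X : Type*} [NormedAddCommGroup X] [InnerProductSpace ℝ X]

theorem IsFracKernel.exists_slobENorm_timeConv_le {β : ℝ} {κ : ℝ → ℝ} (hβ : 1 / 2 < β)
    (hβ1 : β < 1) (hκ : IsFracKernel (2 * β - 1) κ) (T : ℝ) (X : Type*) [NormedAddCommGroup X]
    [InnerProductSpace ℝ X] [CompleteSpace X] :
    ∃ C : ℝ≥0, ∀ w : ℝ → X, MemLp w 2 (timeMeasure T) →
      slobENorm T β (timeConv κ T w) ≤ C * eLpNorm w 2 (timeMeasure T) := by
  obtain ⟨K, hK⟩ := hκ.lintegral_diffQuot_timeConv_le (X := X) hβ hβ1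
  set N := eLpNorm κ 2 (volume.restrict (Ioo (-T) T)) * ENNReal.ofReal T ^ (2⁻¹ : ℝ) with hN
  have hNtop : N ≠ ⊤ := ENNReal.mul_ne_top (hκ.memLp_loc T).2.ne
    (ENNReal.rpow_ne_top_of_nonneg (by norm_num) ENNReal.ofReal_ne_top)
  refine ⟨N.toNNReal + (K.toNNReal) ^ (1 / 2 : ℝ), fun w hw => ?_⟩
  have h1 : eLpNorm (timeConv κ T w) 2 (timeMeasure T) ≤ N * eLpNorm w 2 (timeMeasure T) :=
    eLpNorm_timeConv_le hκ.meas hw.1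
  have h2 : eLpNorm (diffQuot β (timeConv κ T w)) 2 ((timeMeasure T).prod (timeMeasure T)) ≤
      (K.toNNReal : ℝ≥0∞) ^ (1 / 2 : ℝ) * eLpNorm w 2 (timeMeasure T) := by
    have e : ∀ a : ℝ≥0∞, a = (a ^ (2 : ℝ)) ^ (1 / 2 : ℝ) := by
      intro a; rw [← ENNReal.rpow_mul]; norm_num
    rw [e (eLpNorm (diffQuot β _) 2 _), e (eLpNorm w 2 _),
      ← ENNReal.mul_rpow_of_nonneg _ _ (by norm_num), eLpNorm_two_rpow, eLpNorm_two_rpow]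
    refine ENNReal.rpow_le_rpow ?_ (by norm_num)
    calc ∫⁻ p, ‖diffQuot β (timeConv κ T w) p‖ₑ ^ 2 ∂((timeMeasure T).prod (timeMeasure T))
        ≤ ∫⁻ p, ‖diffQuot β (timeConv κ T w) p‖ₑ ^ 2 ∂(volume.prod volume) := by
          rw [timeMeasure, Measure.prod_restrict]
          exact setLIntegral_le_lintegral _ _
      _ ≤ ENNReal.ofReal (K * ∫ r in Ioo 0 T, ‖w r‖ ^ 2) := hK T w hw
      _ ≤ _ := by
          rw [ENNReal.ofReal_mul' (integral_nonneg fun _ => by positivity),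
            ofReal_integral_eq_lintegral_ofReal (hw.integrable_norm_pow (by norm_num))
              (Eventually.of_forall fun _ => by positivity)]
          refine le_of_eq (congrArg₂ _ rfl (lintegral_congr fun s => ?_))
          rw [ENNReal.ofReal_pow (norm_nonneg _), ofReal_norm]
  unfold slobENorm
  refine (ENNReal.rpow_add_rpow_le_add _ _ (by norm_num)).trans ((add_le_add h1 h2).trans_eq ?_)
  rw [← add_mul, ENNReal.coe_add, ENNReal.coe_toNNReal hNtop,
    ENNReal.coe_rpow_of_nonneg _ (by norm_num)]

theorem IsFracKernel.memLp_timeConv {γ : ℝ} {κ : ℝ → ℝ} (hκ : IsFracKernel γ κ) {T : ℝ}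
    {w : ℝ → X} (hw : MemLp w 2 (timeMeasure T)) :
    MemLp (timeConv κ T w) 2 (timeMeasure T) := by
  refine ⟨aestronglyMeasurable_timeConv hκ.meas hw.1,
    (eLpNorm_timeConv_le hκ.meas hw.1).trans_lt ?_⟩
  exact ENNReal.mul_lt_top (ENNReal.mul_lt_top (hκ.memLp_loc T).2
    (ENNReal.rpow_lt_top_of_nonneg (by norm_num) ENNReal.ofReal_ne_top)) hw.2

theorem IsFracKernel.timeConv_add {γ : ℝ} {κ : ℝ → ℝ} (hκ : IsFracKernel γ κ) {T : ℝ}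
    {v w : ℝ → X} (hv : MemLp v 2 (timeMeasure T)) (hw : MemLp w 2 (timeMeasure T)) :
    timeConv κ T (v + w) = timeConv κ T v + timeConv κ T w := by
  funext t
  simp only [timeConv, Pi.add_apply, smul_add]
  exact integral_add (hκ.integrable_smul hv t) (hκ.integrable_smul hw t)

theorem timeConv_smul (κ : ℝ → ℝ) (T c : ℝ) (w : ℝ → X) :
    timeConv κ T (c • w) = c • timeConv κ T w := by
  funext t
  simp only [timeConv, Pi.smul_apply, ← integral_smul]
  refine integral_congr_ae (Eventually.of_forall fun r => ?_)
  exact smul_comm _ _ _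

/-- The convolution over `(0,T)` as a linear operator on `L²(0,T;X)`. -/
def IsFracKernel.convL2 {γ : ℝ} {κ : ℝ → ℝ} (hκ : IsFracKernel γ κ) (T : ℝ) (X : Type*)
    [NormedAddCommGroup X] [InnerProductSpace ℝ X] : L2T T X →ₗ[ℝ] L2T T X where
  toFun w := (hκ.memLp_timeConv (Lp.memLp w)).toLp (timeConv κ T w)
  map_add' v w := by
    rw [← MemLp.toLp_add]
    refine MemLp.toLp_congr _ _ (Eventually.of_forall fun t => ?_)
    rw [timeConv_congr κ (Lp.coeFn_add v w), hκ.timeConv_add (Lp.memLp v) (Lp.memLp w)]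
  map_smul' c w := by
    rw [RingHom.id_apply, ← MemLp.toLp_const_smul]
    refine MemLp.toLp_congr _ _ (Eventually.of_forall fun t => ?_)
    rw [timeConv_congr κ (Lp.coeFn_smul c w), timeConv_smul]

theorem IsFracKernel.coeFn_convL2 {γ : ℝ} {κ : ℝ → ℝ} (hκ : IsFracKernel γ κ) {T : ℝ}
    (w : L2T T X) : hκ.convL2 T X w =ᵐ[timeMeasure T] timeConv κ T w :=
  (hκ.memLp_timeConv (Lp.memLp w)).coeFn_toLp

theorem IsFracKernel.exists_slobENorm_convL2_le {β : ℝ} {κ : ℝ → ℝ} (hβ : 1 / 2 < β)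
    (hβ1 : β < 1) (hκ : IsFracKernel (2 * β - 1) κ) (T : ℝ) (X : Type*) [NormedAddCommGroup X]
    [InnerProductSpace ℝ X] [CompleteSpace X] :
    ∃ C : ℝ≥0, ∀ w : L2T T X, slobENorm T β (hκ.convL2 T X w) ≤ C * ‖w‖ₑ := by
  obtain ⟨C, hC⟩ := hκ.exists_slobENorm_timeConv_le hβ hβ1 T X
  refine ⟨C, fun w => ?_⟩
  rw [slobENorm_congr β (hκ.coeFn_convL2 w), Lp.enorm_def]
  exact hC w (Lp.memLp w)

theorem IsFracKernel.locallyIntegrable {γ : ℝ} {κ : ℝ → ℝ} (hκ : IsFracKernel γ κ) :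
    LocallyIntegrable κ volume := by
  intro x
  refine ⟨Ioo (-(|x| + 1)) (|x| + 1), Ioo_mem_nhds ?_ ?_,
    (hκ.memLp_loc (|x| + 1)).integrable (by norm_num)⟩
  · linarith [neg_abs_le x]
  · linarith [le_abs_self x]

/-- The derivative falls on the test function. Since that function is supported in $(0,T)$,
restricting the integral to $(0,T)$ changes nothing and a convolution on the line results. At $e$
the kernel itself vanishes over the range of integration. -/
theorem IsFracKernel.isC1Vanishing_timeConv {γ : ℝ} {κ : ℝ → ℝ} (hκ : IsFracKernel γ κ) {T e : ℝ}
    (he : ∀ r ∈ Ioo 0 T, κ (e - r) = 0) {ψ : ℝ → X} (hψ : ContDiff ℝ 1 ψ)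
    (hc : HasCompactSupport ψ) (hs : tsupport ψ ⊆ Ioo 0 T) :
    IsC1Vanishing T e (timeConv κ T ψ) := by
  have heq : timeConv κ T ψ = convolution κ ψ (ContinuousLinearMap.lsmul ℝ ℝ) volume := by
    funext t
    rw [convolution_lsmul_swap, timeConv_eq_integral,
      indicator_eq_self.2 ((subset_tsupport ψ).trans hs)]
  constructor
  · rw [heq]
    exact (hc.contDiff_convolution_right (n := 1) _ hκ.locallyIntegrable
      (by exact_mod_cast hψ)).contDiffOn
  · rw [timeConv]
    refine (setIntegral_congr_fun measurableSet_Ioo (g := fun _ => (0 : X)) fun r hr => ?_).trans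
      (by simp)
    simp [he r hr]

/-- An operator bounded from $L^2$ to $H^\beta$ pulls a closed subspace back to a closed one; this
reduces membership in the closure spaces to a dense set. -/
theorem isClosed_comap_fracH {T e β : ℝ} {J : L2T T X →ₗ[ℝ] L2T T X} {C : ℝ≥0}
    (hC : ∀ w, slobENorm T β (J w) ≤ C * ‖w‖ₑ) :
    IsClosed ((fracH T e β X).comap J : Set (L2T T X)) := by
  refine isClosed_of_closure_subset fun w hw => ?_
  refine ⟨(hC w).trans_lt (ENNReal.mul_lt_top ENNReal.coe_lt_top enorm_lt_top), fun ε hε => ?_⟩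
  have hδ : 0 < ε / 2 / (C + 1 : ℝ≥0) :=
    ENNReal.div_pos (ENNReal.half_pos hε.ne').ne' ENNReal.coe_ne_top
  obtain ⟨w', hw', hd⟩ := EMetric.mem_closure_iff.1 hw _ hδ
  obtain ⟨ψ, hψ, h1⟩ := hw'.2 (ε / 2) (ENNReal.half_pos hε.ne')
  refine ⟨ψ, hψ, ?_⟩
  have heq : (fun t => J w t - ψ t) =ᵐ[timeMeasure T]
      (J (w - w') : L2T T X) + fun t => J w' t - ψ t := by
    rw [map_sub]
    filter_upwards [Lp.coeFn_sub (J w) (J w')] with t ht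
    rw [Pi.add_apply, ht, Pi.sub_apply]
    abel
  rw [slobENorm_congr β heq]
  refine (slobENorm_add_le (Lp.aestronglyMeasurable _)
    ((Lp.aestronglyMeasurable _).sub hψ.aesm)).trans_lt ?_
  refine (ENNReal.add_lt_add ?_ h1).trans_eq (ENNReal.add_halves ε)
  refine (hC _).trans_lt (lt_of_le_of_lt ?_ (ENNReal.mul_lt_of_lt_div' hd))
  rw [edist_eq_enorm_sub]
  gcongr
  exact_mod_cast (le_self_add : C ≤ C + 1)

variable [CompleteSpace X]

/-- A closed subspace of `L²(0,T;X)` that contains the products of vectors with test functions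
is the whole space. -/
theorem eq_top_of_contDiff_smul_mem {T : ℝ} {P : Submodule ℝ (L2T T X)}
    (hP : IsClosed (P : Set (L2T T X)))
    (h : ∀ (φ : ℝ → ℝ) (x : X) (hφ : MemLp (fun t => φ t • x) 2 (timeMeasure T)),
      ContDiff ℝ ∞ φ → HasCompactSupport φ → tsupport φ ⊆ Ioo 0 T → hφ.toLp _ ∈ P) :
    P = ⊤ := by
  -- It suffices that the orthogonal complement is trivial: if $w$ is orthogonal to every $\varphi
  -- x$, then $\int\varphi w=0$ for all test functions $\varphi$, and $w=0$ almost everywhere.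
  rw [← hP.submodule_topologicalClosure_eq, Submodule.topologicalClosure_eq_top_iff,
    Submodule.eq_bot_iff]
  intro w hw
  have hwi : Integrable w (timeMeasure T) := (Lp.memLp w).integrable (by norm_num)
  have hae : ∀ᵐ t, t ∈ Ioo 0 T → w t = 0 := by
    refine isOpen_Ioo.ae_eq_zero_of_integral_contDiff_smul_eq_zero
      (IntegrableOn.locallyIntegrableOn hwi) fun φ hφ hc hs => ?_
    have hset : ∫ t, φ t • w t = ∫ t in Ioo 0 T, φ t • w t := by
      rw [setIntegral_eq_integral_of_forall_compl_eq_zero]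
      intro t ht
      rw [image_eq_zero_of_notMem_tsupport fun h => ht (hs h), zero_smul]
    obtain ⟨B, hB⟩ := hc.exists_bound_of_continuous hφ.continuous
    have hi : Integrable (fun t => φ t • w t) (timeMeasure T) :=
      hwi.bdd_smul B hφ.continuous.aestronglyMeasurable (Eventually.of_forall hB)
    rw [hset]
    refine ext_inner_left ℝ fun x => ?_
    have hm : MemLp (fun t => φ t • x) 2 (timeMeasure T) :=
      ((hφ.continuous.smul continuous_const).memLp_of_hasCompactSupport
        (hc.smul_right (f' := fun _ => x))).restrict _
    have h0 := hw _ (h φ x hm hφ hc hs)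
    rw [inner_zero_right, ← integral_inner hi]
    rw [L2.inner_def] at h0
    rw [← h0]
    refine integral_congr_ae ?_
    filter_upwards [hm.coeFn_toLp] with t ht
    rw [ht, real_inner_smul_left, real_inner_smul_right]
  refine Lp.ext ?_
  filter_upwards [Lp.coeFn_zero X 2 (timeMeasure T),
    (ae_restrict_iff' measurableSet_Ioo).2 hae] with t h1 h2
  rw [h1, h2]; rfl

/-- The admissible inputs form a closed subspace containing all $\varphi x$ with $\varphi$ a test
function, for which the convolution is its own $C^1$ approximant. -/
theorem IsFracKernel.convL2_mem_fracH {β : ℝ} {κ : ℝ → ℝ} (hβ : 1 / 2 < β)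
    (hβ1 : β < 1) (hκ : IsFracKernel (2 * β - 1) κ) {T e : ℝ}
    (he : ∀ r ∈ Ioo 0 T, κ (e - r) = 0) (w : L2T T X) :
    hκ.convL2 T X w ∈ fracH T e β X := by
  obtain ⟨C, hC⟩ := hκ.exists_slobENorm_convL2_le hβ hβ1 T X
  have htop := eq_top_of_contDiff_smul_mem (isClosed_comap_fracH (e := e) hC)
    fun φ x hφ h1 h2 h3 => by
      refine ⟨(hC _).trans_lt (ENNReal.mul_lt_top ENNReal.coe_lt_top enorm_lt_top),
        fun ε hε => ⟨timeConv κ T fun t => φ t • x, ?_, ?_⟩⟩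
      · have hsub : tsupport (fun t => φ t • x) ⊆ tsupport φ :=
          closure_mono (Function.support_smul_subset_left φ fun _ => x)
        exact hκ.isC1Vanishing_timeConv he
          ((h1.of_le (by exact_mod_cast le_top)).smul contDiff_const)
          (h2.smul_right (f' := fun _ => x)) (hsub.trans h3)
      · have : (fun t => (hκ.convL2 T X (hφ.toLp _) : L2T T X) t -
            timeConv κ T (fun t => φ t • x) t) =ᵐ[timeMeasure T] fun _ => (0 : X) := by
          filter_upwards [hκ.coeFn_convL2 (hφ.toLp fun t => φ t • x)] with t ht
          rw [ht, timeConv_congr κ hφ.coeFn_toLp, sub_self]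
        rw [slobENorm_congr β this]
        have h0 : diffQuot β (fun _ : ℝ => (0 : X)) = 0 := by funext p; simp [diffQuot]
        simpa [slobENorm, h0] using hε
  exact (htop ▸ Submodule.mem_top : w ∈ (fracH T e β X).comap (hκ.convL2 T X))

end

end FracDiff

end

/-! ### Riemann–Liouville integrals, their duals, and the passage to the regular problem. -/

noncomputable section

namespace FracDiff

/-- The kernel of the forward Riemann-Liouville integral. -/
def rlKernel (β x : ℝ) : ℝ := (Real.Gamma β)⁻¹ * posPow β x

theorem measurable_rlKernel (β : ℝ) : Measurable (rlKernel β) :=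
  (measurable_posPow β).const_mul _

theorem integrableOn_rlKernel {β : ℝ} (hβ : 0 < β) (R : ℝ) :
    IntegrableOn (rlKernel β) (Ioo (-R) R) := (integrableOn_posPow hβ R).const_mul _

theorem rlKernel_of_nonpos {β x : ℝ} (hx : x ≤ 0) : rlKernel β x = 0 := by
  rw [rlKernel, posPow_of_nonpos hx, mul_zero]

theorem isFracKernel_rlKernel {β : ℝ} (hβ : 1 / 2 < β) (hβ1 : β < 1) :
    IsFracKernel (2 * β - 1) (rlKernel β) := (isFracKernel_posPow hβ hβ1).const_mul _

/-- The kernel of the backward Riemann-Liouville integral. -/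
def rlKernelBwd (β x : ℝ) : ℝ := rlKernel β (-x)

theorem integrableOn_rlKernelBwd {β : ℝ} (hβ : 0 < β) (R : ℝ) :
    IntegrableOn (rlKernelBwd β) (Ioo (-R) R) := by
  have := ((Measure.measurePreserving_neg (volume : Measure ℝ)).integrableOn_comp_preimage
    (MeasurableEquiv.neg ℝ).measurableEmbedding).2 (integrableOn_rlKernel hβ R)
  rwa [show Neg.neg ⁻¹' Ioo (-R) R = Ioo (-R) R by simp] at this

theorem rlKernelBwd_of_nonneg {β x : ℝ} (hx : 0 ≤ x) : rlKernelBwd β x = 0 :=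
  rlKernel_of_nonpos (neg_nonpos.2 hx)

theorem isFracKernel_rlKernelBwd {β : ℝ} (hβ : 1 / 2 < β) (hβ1 : β < 1) :
    IsFracKernel (2 * β - 1) (rlKernelBwd β) := (isFracKernel_rlKernel hβ hβ1).comp_neg

variable {X Y : Type*} [NormedAddCommGroup X] [InnerProductSpace ℝ X]
  [NormedAddCommGroup Y] [InnerProductSpace ℝ Y]

theorem negOfL2_apply {T β : ℝ} (u : L2T T X) (φ : fracH T T β X) :
    (negOfL2 β u : fracH T T β X →ₗ[ℝ] ℝ) φ = inner ℝ u (φ : L2T T X) := rfl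

theorem negIncl_apply {T α β : ℝ} (hαβ : α ≤ β) (y : NegH T α X) (φ : fracH T T β X) :
    (negIncl hαβ y : fracH T T β X →ₗ[ℝ] ℝ) φ =
      (y : fracH T T α X →ₗ[ℝ] ℝ) (Submodule.inclusion (fracH_mono hαβ) φ) := rfl

theorem IsDualRL.sub_of_add_eq {T β : ℝ} {y₁ y₂ y : NegH T β X} {g g₂ : L2T T X}
    (heq : y₁ + y₂ = y) (h : IsDualRL y g) (h₂ : IsDualRL y₂ g₂) : IsDualRL y₁ (g - g₂) := by
  intro w φ hφ
  rw [inner_sub_left, h w φ hφ, h₂ w φ hφ, ← heq]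
  exact add_sub_cancel_right ((y₁ : fracH T T β X →ₗ[ℝ] ℝ) φ) _

theorem rlBackward_eq_timeConv {T β t : ℝ} (w : ℝ → X) (ht : 0 ≤ t) :
    rlBackward T β w t = timeConv (rlKernelBwd β) T w t := by
  have h : ∀ r, (rlKernelBwd β (t - r)) • w r =
      (Real.Gamma β)⁻¹ • (Ioi t).indicator (fun r => ((r - t) ^ (β - 1)) • w r) r := by
    intro r
    rw [rlKernelBwd, rlKernel, neg_sub, mul_smul]
    congr 1
    by_cases hr : t < r
    · rw [posPow_of_pos (sub_pos.2 hr), indicator_of_mem (mem_Ioi.2 hr)]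
    · rw [posPow_of_nonpos (by linarith), indicator_of_notMem (by simpa using hr), zero_smul]
  have hset : Ioo 0 T ∩ Ioi t = Ioo t T := by
    ext r; simp only [mem_inter_iff, mem_Ioo, mem_Ioi]
    exact ⟨fun h => ⟨h.2, h.1.2⟩, fun h => ⟨⟨ht.trans_lt h.1, h.2⟩, h.1⟩⟩
  simp only [rlBackward, timeConv, h]
  rw [integral_smul, setIntegral_indicator measurableSet_Ioi, hset]

theorem rlBackward_ae_eq {T β : ℝ} (w : ℝ → X) :
    rlBackward T β w =ᵐ[timeMeasure T] timeConv (rlKernelBwd β) T w := by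
  filter_upwards [ae_restrict_mem measurableSet_Ioo] with t ht
  exact rlBackward_eq_timeConv w ht.1.le

/-! ### Commutation of the fractional integrals -/

/-- For times in $(0,T)$ only kernel arguments in $(-T,T)$ occur; cutting the kernel there makes it
integrable on the line, so convolution theory applies. -/
theorem timeConv_eq_convolution {κ : ℝ → ℝ} {T t : ℝ} (w : ℝ → X) (ht : t ∈ Ioo 0 T) :
    timeConv κ T w t = convolution ((Ioo (-T) T).indicator κ) ((Ioo 0 T).indicator w)
      (ContinuousLinearMap.lsmul ℝ ℝ) volume t := by
  rw [convolution_lsmul_swap, timeConv_eq_integral]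
  refine integral_congr_ae (Eventually.of_forall fun r => ?_)
  dsimp only
  by_cases hr : r ∈ Ioo 0 T
  · have : t - r ∈ Ioo (-T) T := ⟨by linarith [ht.1, hr.2], by linarith [ht.2, hr.1]⟩
    rw [indicator_of_mem this]
  · simp [hr]

/-- The intermediate restriction to $(0,T)$ may be dropped by causality: for $s\le0$ the outer
backward kernel vanishes at $t-s$, and for $s\ge T$ the inner integral is zero. -/
theorem timeConv_timeConv_eq_convolution {T t α β : ℝ} (w : ℝ → X) (ht : t ∈ Ioo 0 T) :
    timeConv (rlKernelBwd α) T (timeConv (rlKernelBwd β) T w) t =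
      convolution ((Ioo (-T) T).indicator (rlKernelBwd α))
        (convolution ((Ioo (-T) T).indicator (rlKernelBwd β)) ((Ioo 0 T).indicator w)
          (ContinuousLinearMap.lsmul ℝ ℝ) volume) (ContinuousLinearMap.lsmul ℝ ℝ) volume t := by
  rw [timeConv_eq_convolution _ ht, convolution_lsmul_swap, convolution_lsmul_swap]
  refine integral_congr_ae (Eventually.of_forall fun s => ?_)
  dsimp only
  by_cases hs : s ∈ Ioo 0 T
  · rw [indicator_of_mem hs, timeConv_eq_convolution w hs]
  rw [indicator_of_notMem hs, smul_zero]
  rcases le_or_gt s 0 with h0 | h0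
  · have : (Ioo (-T) T).indicator (rlKernelBwd α) (t - s) = 0 := by
      rw [indicator_apply_eq_zero]
      exact fun _ => rlKernelBwd_of_nonneg (by linarith [ht.1])
    rw [this, zero_smul]
  · have hsT : T ≤ s := not_lt.1 fun h => hs ⟨h0, h⟩
    rw [convolution_lsmul_swap]
    have : ∀ r, (Ioo (-T) T).indicator (rlKernelBwd β) (s - r) • (Ioo 0 T).indicator w r = 0 := by
      intro r
      by_cases hr : r ∈ Ioo 0 T
      · have : (Ioo (-T) T).indicator (rlKernelBwd β) (s - r) = 0 := by
          rw [indicator_apply_eq_zero]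
          exact fun _ => rlKernelBwd_of_nonneg (by linarith [hr.2])
        rw [this, zero_smul]
      · rw [indicator_of_notMem hr, smul_zero]
    simp [this]

/-- Associativity moves both scalar kernels into a single convolution, where they commute. -/
theorem convolution_left_comm_ae [CompleteSpace X] {f g : ℝ → ℝ} {w : ℝ → X} (hf : Integrable f) (hg : Integrable g)
    (hw : Integrable w) :
    convolution f (convolution g w (ContinuousLinearMap.lsmul ℝ ℝ) volume)
        (ContinuousLinearMap.lsmul ℝ ℝ) volume =ᵐ[volume]
      convolution g (convolution f w (ContinuousLinearMap.lsmul ℝ ℝ) volume)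
        (ContinuousLinearMap.lsmul ℝ ℝ) volume := by
  have assoc : ∀ f g : ℝ → ℝ, Integrable f → Integrable g →
      ∀ᵐ t, convolution (convolution f g (ContinuousLinearMap.mul ℝ ℝ) volume) w
        (ContinuousLinearMap.lsmul ℝ ℝ) volume t =
      convolution f (convolution g w (ContinuousLinearMap.lsmul ℝ ℝ) volume)
        (ContinuousLinearMap.lsmul ℝ ℝ) volume t := by
    intro f g hf hg
    have h1 := hg.norm.integrable_convolution (ContinuousLinearMap.mul ℝ ℝ) hw.norm
    filter_upwards [hf.norm.ae_convolution_exists (ContinuousLinearMap.mul ℝ ℝ) h1] with t ht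
    refine convolution_assoc (ContinuousLinearMap.mul ℝ ℝ) (ContinuousLinearMap.lsmul ℝ ℝ)
      (ContinuousLinearMap.lsmul ℝ ℝ) (ContinuousLinearMap.lsmul ℝ ℝ) ?_ hf.1 hg.1 hw.1
      (hf.ae_convolution_exists _ hg) (hg.norm.ae_convolution_exists _ hw.norm) ht
    intro x y z
    exact mul_smul x y z
  have comm : convolution f g (ContinuousLinearMap.mul ℝ ℝ) volume =
      convolution g f (ContinuousLinearMap.mul ℝ ℝ) volume := by
    funext t
    rw [convolution_mul, convolution_mul_swap]
    simp only [mul_comm]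
  filter_upwards [assoc f g hf hg, assoc g f hg hf] with t h1 h2
  rw [← h1, ← h2, comm]

/-- Backward Riemann-Liouville integrals commute. -/
theorem timeConv_comm_ae [CompleteSpace X] {T α β : ℝ} (hα : 0 < α) (hβ : 0 < β) {w : ℝ → X}
    (hw : Integrable w (timeMeasure T)) :
    timeConv (rlKernelBwd α) T (timeConv (rlKernelBwd β) T w) =ᵐ[timeMeasure T]
      timeConv (rlKernelBwd β) T (timeConv (rlKernelBwd α) T w) := by
  have h := convolution_left_comm_ae
    ((integrable_indicator_iff measurableSet_Ioo).2 (integrableOn_rlKernelBwd hα T))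
    ((integrable_indicator_iff measurableSet_Ioo).2 (integrableOn_rlKernelBwd hβ T))
    ((integrable_indicator_iff measurableSet_Ioo).2 hw)
  filter_upwards [ae_restrict_mem measurableSet_Ioo, ae_restrict_of_ae h] with t ht h1
  rw [timeConv_timeConv_eq_convolution w ht, timeConv_timeConv_eq_convolution w ht, h1]

/-! ### Duality of forward and backward integrals -/

/-- Bounding $\|u\|\|w\|$ by $\|u\|^2+\|w\|^2$ leaves an integrable kernel convolved with integrable
functions; this licenses Fubini in the duality below. -/
theorem integrable_kernel_mul_inner {κ : ℝ → ℝ} {T : ℝ} (hκm : Measurable κ)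
    (hκ : IntegrableOn κ (Ioo (-T) T)) {u w : ℝ → X} (hu : MemLp u 2 (timeMeasure T))
    (hw : MemLp w 2 (timeMeasure T)) :
    Integrable (fun z : ℝ × ℝ => κ (z.1 - z.2) * inner ℝ (u z.2) (w z.1))
      ((timeMeasure T).prod (timeMeasure T)) := by
  have hi : ∀ v : ℝ → X, MemLp v 2 (timeMeasure T) →
      Integrable ((Ioo 0 T).indicator fun t => ‖v t‖ ^ 2) := fun v hv =>
    (integrable_indicator_iff measurableSet_Ioo).2 (hv.integrable_norm_pow (by norm_num))
  have hκi := ((integrable_indicator_iff measurableSet_Ioo).2 hκ).abs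
  have hb := ((integrable_comp_sub_mul hκi (hi u hu)).1.add
    (integrable_comp_sub_mul_left hκi (hi w hw)).1).integrableOn (s := Ioo 0 T ×ˢ Ioo 0 T)
  rw [IntegrableOn, ← Measure.prod_restrict] at hb
  refine hb.mono' ?_ ?_
  · exact (hκm.comp (measurable_fst.sub measurable_snd)).aestronglyMeasurable.mul
      (hu.1.comp_snd.inner hw.1.comp_fst)
  · rw [Measure.prod_restrict]
    filter_upwards [ae_restrict_mem (measurableSet_Ioo.prod measurableSet_Ioo)] with z hz
    obtain ⟨h1, h2⟩ := hz
    have h3 : z.1 - z.2 ∈ Ioo (-T) T := ⟨by linarith [h1.1, h2.2], by linarith [h1.2, h2.1]⟩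
    rw [Pi.add_apply, indicator_of_mem h1, indicator_of_mem h2, indicator_of_mem h3, norm_mul, Real.norm_eq_abs]
    refine (mul_le_mul_of_nonneg_left (norm_inner_le_norm _ _) (abs_nonneg _)).trans ?_
    rw [← mul_add]
    refine mul_le_mul_of_nonneg_left ?_ (abs_nonneg _)
    nlinarith [sq_nonneg (‖u z.2‖ - ‖w z.1‖), sq_nonneg ‖u z.2‖, sq_nonneg ‖w z.1‖]

/-- By Fubini, the adjoint of a convolution is the convolution with the reflected kernel, so forward
and backward integrals are adjoint to each other. -/
theorem IsFracKernel.inner_convL2 [CompleteSpace X] {γ : ℝ} {κ : ℝ → ℝ} (hκ : IsFracKernel γ κ)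
    (hκ' : IsFracKernel γ fun x => κ (-x)) {T : ℝ} (u w : L2T T X) :
    inner ℝ (hκ.convL2 T X u) w = inner ℝ u (hκ'.convL2 T X w) := by
  have hi := integrable_kernel_mul_inner (T := T) hκ.meas
    ((hκ.memLp_loc T).integrable (by norm_num)) (Lp.memLp u) (Lp.memLp w)
  rw [L2.inner_def, L2.inner_def]
  calc ∫ t, inner ℝ (hκ.convL2 T X u t) (w t) ∂timeMeasure T
      = ∫ t, ∫ r, κ (t - r) * inner ℝ (u r) (w t) ∂timeMeasure T ∂timeMeasure T := by
        refine integral_congr_ae ?_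
        filter_upwards [hκ.coeFn_convL2 u] with t ht
        rw [ht, real_inner_comm]
        refine (integral_inner (hκ.integrable_smul (Lp.memLp u) t) (w t)).symm.trans ?_
        refine integral_congr_ae (Eventually.of_forall fun r => ?_)
        dsimp only
        rw [real_inner_smul_right, real_inner_comm]
    _ = ∫ r, ∫ t, κ (t - r) * inner ℝ (u r) (w t) ∂timeMeasure T ∂timeMeasure T :=
        integral_integral_swap hi
    _ = ∫ r, inner ℝ (u r) (hκ'.convL2 T X w r) ∂timeMeasure T := by
        refine integral_congr_ae ?_
        filter_upwards [hκ'.coeFn_convL2 w] with r hr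
        rw [hr]
        refine Eq.trans ?_ (integral_inner (hκ'.integrable_smul (Lp.memLp w) r) (u r))
        refine integral_congr_ae (Eventually.of_forall fun t => ?_)
        dsimp only
        rw [real_inner_smul_right, neg_sub]

/-! ### The dual operator of the backward integral -/

section Dual

variable {T β : ℝ} [CompleteSpace X] [CompleteSpace Y]

/-- The backward Riemann-Liouville integral as an operator `L²(0,T;X) → ^βH(0,T;X)`. -/
def rlFracH (hβ : 1 / 2 < β) (hβ1 : β < 1) : L2T T X →ₗ[ℝ] fracH T T β X :=
  ((isFracKernel_rlKernelBwd hβ hβ1).convL2 T X).codRestrict _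
    ((isFracKernel_rlKernelBwd hβ hβ1).convL2_mem_fracH hβ hβ1
      fun _ hr => rlKernelBwd_of_nonneg (sub_nonneg.2 hr.2.le))

theorem coeFn_rlFracH (hβ : 1 / 2 < β) (hβ1 : β < 1) (w : L2T T X) :
    ((rlFracH hβ hβ1 w : fracH T T β X) : L2T T X) =ᵐ[timeMeasure T]
      timeConv (rlKernelBwd β) T w :=
  (isFracKernel_rlKernelBwd hβ hβ1).coeFn_convL2 w

/-- Since $J^\beta w$ is now known to lie in ${}^\beta H$, testing against every representative of
it amounts to testing against this one element, for every $w$. -/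
theorem isDualRL_iff (hβ : 1 / 2 < β) (hβ1 : β < 1) {y : NegH T β X} {g : L2T T X} :
    IsDualRL y g ↔ ∀ w : L2T T X,
      inner ℝ g w = (y : fracH T T β X →ₗ[ℝ] ℝ) (rlFracH hβ hβ1 w) := by
  refine ⟨fun h w => h w _ ((coeFn_rlFracH hβ hβ1 w).trans (rlBackward_ae_eq _).symm),
    fun h w φ hφ => ?_⟩
  rw [h w]
  congr 1
  exact Subtype.ext (Lp.ext ((coeFn_rlFracH hβ hβ1 w).trans
    ((rlBackward_ae_eq _).symm.trans hφ.symm)))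

theorem IsDualRL.unique (hβ : 1 / 2 < β) (hβ1 : β < 1) {y : NegH T β X} {g g' : L2T T X}
    (h : IsDualRL y g) (h' : IsDualRL y g') : g = g' := by
  refine ext_inner_right ℝ fun w => ?_
  rw [(isDualRL_iff hβ hβ1).1 h w, (isDualRL_iff hβ hβ1).1 h' w]

/-- The functional $w\mapsto\langle y,J^\beta w\rangle$ is bounded on $L^2(0,T;X)$ by the
convolution estimate, so Riesz representation applies. -/
theorem exists_isDualRL (hβ : 1 / 2 < β) (hβ1 : β < 1) (y : NegH T β X) :
    ∃ g : L2T T X, IsDualRL y g := by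
  obtain ⟨C, hC⟩ := y.2
  obtain ⟨D, hD⟩ := (isFracKernel_rlKernelBwd hβ hβ1).exists_slobENorm_convL2_le hβ hβ1 T X
  set F : L2T T X →L[ℝ] ℝ :=
    ((y : fracH T T β X →ₗ[ℝ] ℝ) ∘ₗ rlFracH hβ hβ1).mkContinuous (|C| * D) (fun w => by
      refine (hC _).trans ?_
      have h := ENNReal.toReal_mono (ENNReal.mul_ne_top ENNReal.coe_ne_top enorm_ne_top) (hD w)
      rw [ENNReal.toReal_mul, ENNReal.coe_toReal, toReal_enorm] at h
      rw [mul_assoc]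
      exact mul_le_mul (le_abs_self C) h ENNReal.toReal_nonneg (abs_nonneg C)) with hF
  refine ⟨(InnerProductSpace.toDual ℝ (L2T T X)).symm F, (isDualRL_iff hβ hβ1).2 fun w => ?_⟩
  rw [InnerProductSpace.toDual_symm_apply]
  rfl

theorem existsUnique_isDualRL (hβ : 1 / 2 < β) (hβ1 : β < 1) (y : NegH T β X) :
    ∃! g : L2T T X, IsDualRL y g := by
  obtain ⟨g, hg⟩ := exists_isDualRL hβ hβ1 y
  exact ⟨g, hg, fun g' hg' => hg'.unique hβ hβ1 hg⟩

theorem fracHMap_rlFracH (hβ : 1 / 2 < β) (hβ1 : β < 1) (B : X →L[ℝ] Y) (w : L2T T X) :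
    fracHMap B (rlFracH hβ hβ1 w) = rlFracH hβ hβ1 (B.compLp w) := by
  refine Subtype.ext (Lp.ext ?_)
  refine (B.coeFn_compLp' ((rlFracH hβ hβ1 w : fracH T T β X) : L2T T X)).trans ?_
  filter_upwards [coeFn_rlFracH hβ hβ1 w, coeFn_rlFracH hβ hβ1 (B.compLp w)] with t h1 h2
  rw [h1, h2, timeConv_congr _ (B.coeFn_compLp' w), timeConv, timeConv,
    ← B.integral_comp_comm ((isFracKernel_rlKernelBwd hβ hβ1).integrable_smul (Lp.memLp w) t)]
  simp only [map_smul]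

theorem inner_compLp_left (B : X →L[ℝ] Y) (v : L2T T X) (w : L2T T Y) :
    inner ℝ (B.compLp v) w = inner ℝ v ((ContinuousLinearMap.adjoint B).compLp w) := by
  rw [L2.inner_def, L2.inner_def]
  refine integral_congr_ae ?_
  filter_upwards [B.coeFn_compLp' v, (ContinuousLinearMap.adjoint B).coeFn_compLp' w] with t h1 h2
  rw [h1, h2, ContinuousLinearMap.adjoint_inner_right]

/-- $\langle Bg,w\rangle=\langle g,B^*w\rangle=\langle y,J^\beta B^*w\rangle=\langle y,B^*J^\beta
w\rangle$, the last step because $B^*$ passes through the Bochner integral. -/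
theorem IsDualRL.negMap (hβ : 1 / 2 < β) (hβ1 : β < 1) (B : X →L[ℝ] Y) {y : NegH T β X}
    {g : L2T T X} (h : IsDualRL y g) : IsDualRL (FracDiff.negMap B y) (B.compLp g) := by
  refine (isDualRL_iff hβ hβ1).2 fun w => ?_
  rw [inner_compLp_left, (isDualRL_iff hβ hβ1).1 h, ← fracHMap_rlFracH]
  rfl

/-- The dual of the backward integral, on `L²(0,T;X)`, is the forward integral; hence it maps into
`_βH(0,T;X)`. -/
theorem IsDualRL.mem_fracH (hβ : 1 / 2 < β) (hβ1 : β < 1) {u v : L2T T X}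
    (h : IsDualRL (negOfL2 β u) v) : v ∈ fracH T 0 β X := by
  have hv : v = (isFracKernel_rlKernel hβ hβ1).convL2 T X u := by
    refine ext_inner_right ℝ fun w => ?_
    rw [(isDualRL_iff hβ hβ1).1 h w, negOfL2_apply]
    exact ((isFracKernel_rlKernel hβ hβ1).inner_convL2
      (isFracKernel_rlKernelBwd hβ hβ1) u w).symm
  rw [hv]
  exact (isFracKernel_rlKernel hβ hβ1).convL2_mem_fracH hβ hβ1
    (fun r hr => rlKernel_of_nonpos (by linarith [hr.1])) u

/-- The dual of the backward integral of order `β` commutes with the Caputo derivative. -/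
theorem IsCaputo.isDualRL {α : ℝ} (hα : 0 < α) (hαβ : α ≤ β) (hβ : 1 / 2 < β) (hβ1 : β < 1)
    {u v z' : L2T T X} {z : NegH T α X} (hz : IsCaputo u z)
    (hv : IsDualRL (negOfL2 β u) v) (hz' : IsDualRL (negIncl hαβ z) z') :
    IsCaputo v (negOfL2 α z') := by
  -- With $\varphi=J^\alpha w$ the chain is $\langle v,w\rangle=\langle u,J^\beta w\rangle=\langle
  -- z,J^\alpha J^\beta w\rangle=\langle z,J^\beta\varphi\rangle=\langle z',\varphi\rangle$. Here
  -- $J^\beta\varphi\in{}^\beta H\subset{}^\alpha H$ is the admissible test element, so no mapping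
  -- property of $J^\alpha$ is required, even for $\alpha\le1/2$.
  intro w φ hφ
  have hae : (((Submodule.inclusion (fracH_mono hαβ) (rlFracH hβ hβ1 (φ : L2T T X)) :
      fracH T T α X) : L2T T X) : ℝ → X) =ᵐ[timeMeasure T]
      rlBackward T α ((rlFracH hβ hβ1 w : fracH T T β X) : L2T T X) := by
    rw [Submodule.coe_inclusion]
    refine (coeFn_rlFracH hβ hβ1 (φ : L2T T X)).trans (EventuallyEq.trans ?_
      (rlBackward_ae_eq _).symm)
    rw [timeConv_congr _ (hφ.trans (rlBackward_ae_eq _)),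
      timeConv_congr _ (coeFn_rlFracH hβ hβ1 w)]
    exact timeConv_comm_ae (by linarith) hα ((Lp.memLp w).integrable (by norm_num))
  have h2 := (isDualRL_iff hβ hβ1).1 hz' (φ : L2T T X)
  rw [negIncl_apply, ← hz _ _ hae] at h2
  rw [negOfL2_apply, h2, (isDualRL_iff hβ hβ1).1 hv w, negOfL2_apply]

/-- A solution of the abstract singular problem `(∂_t^α + A) u = S μ` is mapped by the dual of the
backward integral to a solution of the regular problem. -/
theorem exists_regular_solution {W : Type*} [NormedAddCommGroup W] [InnerProductSpace ℝ W]
    [CompleteSpace W] {α : ℝ} (hα : 0 < α) (hαβ : α ≤ β) (hβ : 1 / 2 < β) (hβ1 : β < 1)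
    {ι A : W →L[ℝ] X} {S : Y →L[ℝ] X} {μ : NegH T β Y} {u v : L2T T X} {g : L2T T Y}
    {U : NegH T β W} (hU : FracDiff.negMap ι U = negOfL2 β u)
    {z : NegH T α X} (hz : IsCaputo u z)
    (heq : negIncl hαβ z + FracDiff.negMap A U = FracDiff.negMap S μ)
    (hv : IsDualRL (negOfL2 β u) v) (hg : IsDualRL μ g) :
    ∃ V : L2T T W, ι.compLp V = v ∧ ∃ z' : L2T T X, IsCaputo v (negOfL2 α z') ∧
      z' + A.compLp V = S.compLp g := by
  obtain ⟨V, hV⟩ := exists_isDualRL hβ hβ1 U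
  -- Applying $(J^\beta)'$ to $\iota U=u$ gives $\iota V=v$ by uniqueness. Choosing $z'=Sg-AV$ makes
  -- the equation hold by definition; what remains is that this $z'$ is the fractional derivative of
  -- $v$.
  refine ⟨V, (hU ▸ hV.negMap hβ hβ1 ι).unique hβ hβ1 hv, S.compLp g - A.compLp V, ?_,
    sub_add_cancel _ _⟩
  exact hz.isDualRL hα hαβ hβ hβ1 hv
    (.sub_of_add_eq heq (hg.negMap hβ hβ1 S) (hV.negMap hβ hβ1 A))

end Dual

end FracDiff

end

theorem proposition2p1 (d : ℕ) (hd : 1 ≤ d) (Ω : Set (FracDiff.Sp d)) (L : FracDiff.Coeffs d Ω)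
    (T : ℝ) (hT : 0 < T) (α β : ℝ) (hα0 : 0 < α) (hα1 : α < 1) (hαβ : α ≤ β)
    (hβ1 : β < 1) (hβ2 : 1 / 2 < β)
    (μ : FracDiff.NegH T β ℝ) (f : FracDiff.L2Ω Ω)
    (u : FracDiff.L2T T (FracDiff.L2Ω Ω))
    (hu : FracDiff.IsSingularSolution L hαβ μ f u) :
    (∃! v : FracDiff.L2T T (FracDiff.L2Ω Ω),
      FracDiff.IsDualRL (FracDiff.negOfL2 β u) v) ∧
    (∃! g : FracDiff.L2T T ℝ, FracDiff.IsDualRL μ g) ∧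
    ∀ (v : FracDiff.L2T T (FracDiff.L2Ω Ω)) (g : FracDiff.L2T T ℝ),
      FracDiff.IsDualRL (FracDiff.negOfL2 β u) v → FracDiff.IsDualRL μ g →
        v ∈ FracDiff.fracH T 0 β (FracDiff.L2Ω Ω) ∧
        FracDiff.IsRegularSolution L α g f v := by
  refine ⟨FracDiff.existsUnique_isDualRL hβ2 hβ1 _, FracDiff.existsUnique_isDualRL hβ2 hβ1 _,
    fun v g hv hg => ⟨hv.mem_fracH hβ2 hβ1, ?_⟩⟩
  obtain ⟨U, hU, z, hz, heq⟩ := hu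
  exact FracDiff.exists_regular_solution hα0 hαβ hβ2 hβ1 hU hz heq hv hg
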